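/- Let $(M,g)$ be an $n$-dimensional semi-Riemannian manifold of index $s$, $1\le s\le n-1$, and let $\mathcal F$ be a foliation of $M$ of codimension $q$ with $m$-dimensional leaves, $m=n-q$. Suppose that $\mathrm{Rad}\,T\mathcal F = T\mathcal F\cap (T\mathcal F)^\perp$ is a trivial subbundle of $T(M)$ of rank $r$ with $1\le r\le m-1$ and $r\le q-1$, and fix a global $C^\infty$ frame $\xi=(\xi_1,\dots,\xi_r)$ of it. Let $S(T\mathcal F)$ and $S(T\mathcal F^\perp)$ be screen distributions, i.e. $C^\infty$ subbundles with $$T\mathcal F=S(T\mathcal F)\oplus\mathrm{Rad}\,T\mathcal F,\qquad (T\mathcal F)^\perp=S(T\mathcal F^\perp)\oplus\mathrm{Rad}\,T\mathcal F ,$$ and let $E$ be a $C^\infty$ subbundle such that $S(T\mathcal F)^\perp\cap S(T\mathcal F^\perp)^\perp=\mathrm{Rad}\,T\mathcal F\oplus E$. Let $e_i\in E$ be determined by $g(e_i,\xi_j)=\delta_{ij}$ and put $N_i=e_i-\frac12\sum_{j}g(e_i,e_j)\,\xi_j$ $(1\le i\le r)$; these are globally defined, $g(N_i,\xi_j)=\delta_{ij}$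 and $g(N_i,N_j)=0$. Let $tr(T\mathcal F)=\mathrm{span}\{N_1,\dots,N_r\}\oplus S(T\mathcal F^\perp)$, so that $T(M)=T\mathcal F\oplus tr(T\mathcal F)$. Write $\lambda^i=g(\cdot,N_i)$, and for a local $C^\infty$ frame $\{X_a\}_{1\le a\le m-r}$ of $S(T\mathcal F)$ with $g(X_a,X_b)=\epsilon_a\delta_{ab}$, $\epsilon_a=\pm1$, write $\omega^a=g(\cdot,X_a)$. (1) There is exactly one family $\kappa=\kappa(\xi,E)$ of linear forms on the tangent spaces of $M$ such that $\kappa(X)=0$ for $X\in T\mathcal F$ and, for every local orthonormal frame $\{X_a\}$ of $S(T\mathcal F)$ and every local $C^\infty$ section $Z$ of $tr(T\mathcal F)$ over the same open set, $$\kappa(Z)=\sum_{i=1}^r\lambda^i([Z,\xi_i])+\sum_{a=1}^{m-r}\epsilon_a\,\omega^a([Z,X_a]).$$ Moreover $\kappa$ is a $C^\infty$ differential $1$-form on $M$. In other words, $\kappa\in\Omega^1(M)$ is globally well defined and does not depend on the choice of local orthonormal frames of the screen distributions. (2) Suppose that $S(T\mathcal F)$ is oriented. Then there is exactly one field $\chi_{\mathcal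 F}$ of alternating $m$-linear forms on the tangent spaces of $M$ such that $\chi_{\mathcal F}=\lambda^1\wedge\cdots\wedge\lambda^r\wedge\omega^1\wedge\cdots\wedge\omega^{m-r}$ on the domain of each positively oriented local orthonormal frame $\{X_a\}$ of $S(T\mathcal F)$, where $(\theta^1\wedge\cdots\wedge\theta^m)(Y_1,\dots,Y_m)=\frac1{m!}\det[\theta^i(Y_j)]$. It is of class $C^\infty$, and $$(\mathcal L_Z\chi_{\mathcal F})(Y_1,\dots,Y_m)+\kappa(Z)\,\chi_{\mathcal F}(Y_1,\dots,Y_m)=0$$ for every (local) $C^\infty$ section $Z$ of $tr(T\mathcal F)$ and all (local) $C^\infty$ sections $Y_1,\dots,Y_m$ of $T\mathcal F$. -/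

import Mathlib

open Bundle Set Topology
open scoped Manifold ContDiff

noncomputable section

namespace Lightlike

section Basic

variable {n : ℕ} {M : Type*} [TopologicalSpace M]
  [ChartedSpace (EuclideanSpace ℝ (Fin n)) M]

/-- A (not necessarily smooth) family of tangent subspaces. -/
abbrev TangentSubspaces (n : ℕ) (M : Type*) [TopologicalSpace M]
    [ChartedSpace (EuclideanSpace ℝ (Fin n)) M] :=
  ∀ x : M, Submodule ℝ (TangentSpace (𝓡 n) x)

/-- A (not necessarily smooth) vector field. -/
abbrev VField (n : ℕ) (M : Type*) [TopologicalSpace M]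
    [ChartedSpace (EuclideanSpace ℝ (Fin n)) M] :=
  ∀ x : M, TangentSpace (𝓡 n) x

/-- The vector field `X` is of class `C^∞` on `U`. -/
def SmoothFieldOn [IsManifold (𝓡 n) ∞ M] (X : VField n M) (U : Set M) : Prop :=
  ContMDiffOn (𝓡 n) (𝓡 n).tangent ∞ (fun x => (⟨x, X x⟩ : TangentBundle (𝓡 n) M)) U

/-- `X` is a `C^∞` section over `U` of the family of subspaces `D`. -/
structure IsSectionOn [IsManifold (𝓡 n) ∞ M] (D : TangentSubspaces n M) (X : VField n M)
    (U : Set M) : Prop where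
  smooth : SmoothFieldOn X U
  mem : ∀ x ∈ U, X x ∈ D x

/-- `X_1, …, X_k` is a `C^∞` frame of `D` over `U`. -/
structure IsFrameOn [IsManifold (𝓡 n) ∞ M] (D : TangentSubspaces n M) {k : ℕ}
    (X : Fin k → VField n M) (U : Set M) : Prop where
  smooth : ∀ a, SmoothFieldOn (X a) U
  linearIndependent : ∀ x ∈ U, LinearIndependent ℝ (fun a => X a x)
  span_eq : ∀ x ∈ U, Submodule.span ℝ (range fun a => X a x) = D x

/-- `D` is a `C^∞` subbundle of rank `k` of the tangent bundle. -/
def IsSubbundle [IsManifold (𝓡 n) ∞ M] (D : TangentSubspaces n M) (k : ℕ) : Prop :=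
  ∀ x : M, ∃ U : Set M, IsOpen U ∧ x ∈ U ∧ ∃ X : Fin k → VField n M, IsFrameOn D X U

/-- The direct sum decomposition `D = A ⊕ B` at each point. -/
structure IsDirectSum (D A B : TangentSubspaces n M) : Prop where
  sup_eq : ∀ x, A x ⊔ B x = D x
  inf_eq : ∀ x, A x ⊓ B x = ⊥

/-- A semi-Riemannian metric of index `s`: a `C^∞` field of nondegenerate symmetric bilinear
forms on the tangent spaces, all of index `s` (the maximal dimension of a negative definite
subspace). -/
structure SemiRiemannianMetric (n s : ℕ) (M : Type*) [TopologicalSpace M]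
    [ChartedSpace (EuclideanSpace ℝ (Fin n)) M] [IsManifold (𝓡 n) ∞ M] where
  toFun : ∀ x : M, TangentSpace (𝓡 n) x →L[ℝ] TangentSpace (𝓡 n) x →L[ℝ] ℝ
  symm : ∀ x v w, toFun x v w = toFun x w v
  nondegenerate : ∀ x v, (∀ w, toFun x v w = 0) → v = 0
  index_eq : ∀ x, sigNeg (LinearMap.BilinMap.toQuadraticMap
    (LinearMap.mk₂ ℝ (fun v w => toFun x v w) (by simp) (by simp) (by simp) (by simp))) = s
  smooth : ContMDiff (𝓡 n) ((𝓡 n).prod 𝓘(ℝ, EuclideanSpace ℝ (Fin n) →L[ℝ]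
      EuclideanSpace ℝ (Fin n) →L[ℝ] ℝ)) ∞
    (fun x => TotalSpace.mk' (EuclideanSpace ℝ (Fin n) →L[ℝ] EuclideanSpace ℝ (Fin n) →L[ℝ] ℝ)
      (E := fun x : M => TangentSpace (𝓡 n) x →L[ℝ] TangentSpace (𝓡 n) x →L[ℝ] ℝ) x (toFun x))

variable [IsManifold (𝓡 n) ∞ M] {s : ℕ}

instance : CoeFun (SemiRiemannianMetric n s M)
    (fun _ => ∀ x : M, TangentSpace (𝓡 n) x →L[ℝ] TangentSpace (𝓡 n) x →L[ℝ] ℝ) :=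
  ⟨SemiRiemannianMetric.toFun⟩

/-- The orthogonal complement `D^⊥` in the tangent bundle. -/
def SemiRiemannianMetric.orth (g : SemiRiemannianMetric n s M) (D : TangentSubspaces n M) :
    TangentSubspaces n M := fun x =>
  { carrier := {v | ∀ w ∈ D x, g x v w = 0}
    add_mem' := fun {a b} ha hb w hw => by
      rw [map_add, add_apply, ha w hw, hb w hw, add_zero]
    zero_mem' := fun w _ => by simp
    smul_mem' := fun c v hv w hw => by
      rw [map_smul, smul_apply, hv w hw, smul_zero] }

/-- The covector `g (·, w)` at `x`. -/
def SemiRiemannianMetric.covector (g : SemiRiemannianMetric n s M) {x : M}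
    (w : TangentSpace (𝓡 n) x) : TangentSpace (𝓡 n) x →ₗ[ℝ] ℝ where
  toFun v := g x v w
  map_add' := by simp
  map_smul' := by simp

/-- A foliation with leaves of dimension `m` (codimension `n - m`), given by its tangent spaces:
around each point there is a chart `φ` of the `C^∞` structure, with values
`(x_1, …, x_m, y_1, …, y_q)`, such that the tangent space of the foliation is the kernel of
`(dy_1, …, dy_q)`; the leaves are made of the plaques `y = const` of these foliated charts. -/
structure Foliation (n m : ℕ) (M : Type*) [TopologicalSpace M]
    [ChartedSpace (EuclideanSpace ℝ (Fin n)) M] [IsManifold (𝓡 n) ∞ M] where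
  tangent : TangentSubspaces n M
  exists_foliatedChart : ∀ x : M, ∃ φ ∈ IsManifold.maximalAtlas (𝓡 n) ∞ M, x ∈ φ.source ∧
    ∀ y ∈ φ.source, ∀ v : TangentSpace (𝓡 n) y, v ∈ tangent y ↔
      ∀ i : Fin n, m ≤ i.val →
        (show EuclideanSpace ℝ (Fin n) from mfderiv (𝓡 n) (𝓡 n) φ y v) i = 0

/-- The tangential radical distribution `Rad TF = TF ∩ (TF)^⊥`. -/
def Foliation.radical {m : ℕ} (F : Foliation n m M) (g : SemiRiemannianMetric n s M) :
    TangentSubspaces n M := fun x => F.tangent x ⊓ g.orth F.tangent x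

/-- Screen distributions `S = S(TF)` and `S' = S(TF^⊥)` of a foliation with leaves of dimension
`m` and codimension `q`, whose radical distribution has rank `r`. -/
structure IsScreenPair {m : ℕ} (q r : ℕ) (g : SemiRiemannianMetric n s M) (F : Foliation n m M)
    (S S' : TangentSubspaces n M) : Prop where
  screen_subbundle : IsSubbundle S (m - r)
  screen_compl : IsDirectSum F.tangent S (F.radical g)
  coscreen_subbundle : IsSubbundle S' (q - r)
  coscreen_compl : IsDirectSum (g.orth F.tangent) S' (F.radical g)

/-- `E` is a `C^∞` complement to `Rad TF` in the orthogonal complement of `S'` in `S^⊥`. -/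
structure IsRadicalComplement {m : ℕ} (r : ℕ) (g : SemiRiemannianMetric n s M)
    (F : Foliation n m M) (S S' E : TangentSubspaces n M) : Prop where
  subbundle : IsSubbundle E r
  compl : IsDirectSum (fun x => g.orth S x ⊓ g.orth S' x) E (F.radical g)

/-- A vector orthogonal to `D^⊥` lies in `D`. -/
theorem SemiRiemannianMetric.mem_of_orth_orth (g : SemiRiemannianMetric n s M)
    (D : TangentSubspaces n M) {x : M} {v : TangentSpace (𝓡 n) x}
    (hv : ∀ w ∈ g.orth D x, g x v w = 0) : v ∈ D x := by
  have : FiniteDimensional ℝ (TangentSpace (𝓡 n) x) :=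
    inferInstanceAs (FiniteDimensional ℝ (EuclideanSpace ℝ (Fin n)))
  let B : LinearMap.BilinForm ℝ (TangentSpace (𝓡 n) x) :=
    LinearMap.mk₂ ℝ (fun v w => g x v w) (by simp) (by simp) (by simp) (by simp)
  have hsymm : ∀ a b, B a b = B b a := fun a b => g.symm x a b
  have hrefl : B.IsRefl := fun a b h => by rw [hsymm]; exact h
  have hnd : B.Nondegenerate := by
    refine ⟨fun a h => g.nondegenerate x a h, fun a h => g.nondegenerate x a fun w => ?_⟩
    rw [g.symm]; exact h w
  have h2 := LinearMap.BilinForm.orthogonal_orthogonal hnd hrefl (D x)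
  rw [← h2, LinearMap.BilinForm.mem_orthogonal_iff]
  intro w hw
  rw [LinearMap.BilinForm.mem_orthogonal_iff] at hw
  change g x w v = 0
  rw [g.symm]
  refine hv w fun u hu => ?_
  rw [g.symm]; exact hw u hu

/-- The vectors `e_i ∈ E_x` dual to the frame `ξ` of the radical distribution exist and are
unique. -/
theorem existsUnique_dualFrame {m q r : ℕ} {g : SemiRiemannianMetric n s M} {F : Foliation n m M}
    {ξ : Fin r → VField n M} (hξ : IsFrameOn (F.radical g) ξ univ) {S S' E : TangentSubspaces n M}
    (hS : IsScreenPair q r g F S S') (hE : IsRadicalComplement r g F S S' E) (i : Fin r) (x : M) :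
    ∃! e, e ∈ E x ∧ ∀ j, g x e (ξ j x) = if i = j then 1 else 0 := by
  have : FiniteDimensional ℝ (TangentSpace (𝓡 n) x) :=
    inferInstanceAs (FiniteDimensional ℝ (EuclideanSpace ℝ (Fin n)))
  let Φ : E x →ₗ[ℝ] (Fin r → ℝ) :=
    LinearMap.pi fun j => (g.covector (ξ j x)).comp (E x).subtype
  have hΦ : ∀ e j, Φ e j = g x e (ξ j x) := fun _ _ => rfl
  have hinj : Function.Injective Φ := by
    rw [← LinearMap.ker_eq_bot, LinearMap.ker_eq_bot']
    intro e he
    have hrad : ∀ w ∈ F.radical g x, g x e w = 0 := by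
      intro w hw
      rw [← hξ.span_eq x (mem_univ x)] at hw
      induction hw using Submodule.span_induction with
      | mem w hw => obtain ⟨j, rfl⟩ := hw; exact (hΦ e j).symm.trans (congrFun he j)
      | zero => simp
      | add a b _ _ ha hb => rw [map_add, ha, hb, add_zero]
      | smul c a _ ha => rw [map_smul, ha, smul_zero]
    have hmem : (e : TangentSpace (𝓡 n) x) ∈ g.orth S x ⊓ g.orth S' x := by
      rw [← hE.compl.sup_eq x]; exact Submodule.mem_sup_left e.2
    have h1 : (e : TangentSpace (𝓡 n) x) ∈ g.orth F.tangent x := by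
      intro w hw
      rw [← hS.screen_compl.sup_eq x] at hw
      obtain ⟨a, ha, b, hb, rfl⟩ := Submodule.mem_sup.1 hw
      rw [map_add, hmem.1 a ha, hrad b hb, add_zero]
    have h2 : (e : TangentSpace (𝓡 n) x) ∈ F.tangent x := by
      refine g.mem_of_orth_orth _ fun w hw => ?_
      rw [← hS.coscreen_compl.sup_eq x] at hw
      obtain ⟨a, ha, b, hb, rfl⟩ := Submodule.mem_sup.1 hw
      rw [map_add, hmem.2 a ha, hrad b hb, add_zero]
    have h3 : (e : TangentSpace (𝓡 n) x) ∈ E x ⊓ F.radical g x := ⟨e.2, h2, h1⟩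
    rw [hE.compl.inf_eq x, Submodule.mem_bot] at h3
    exact Subtype.ext h3
  have hrank : Module.finrank ℝ (E x) = Module.finrank ℝ (Fin r → ℝ) := by
    obtain ⟨U, -, hx, V, hV⟩ := hE.subbundle x
    rw [← hV.span_eq x hx, finrank_span_eq_card (hV.linearIndependent x hx)]
    simp
  have hsurj := (LinearMap.injective_iff_surjective_of_finrank_eq_finrank hrank).1 hinj
  obtain ⟨e, he⟩ := hsurj fun j => if i = j then 1 else 0
  refine ⟨e, ⟨e.2, fun j => (hΦ e j).symm.trans (congrFun he j)⟩, ?_⟩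
  rintro e' ⟨h1, h2⟩
  have : (⟨e', h1⟩ : E x) = e := hinj (funext fun j => by rw [he]; exact h2 j)
  exact congrArg Subtype.val this

/-- The vectors `e_i ∈ E_x` with `g (e_i, ξ_j) = δ_ij`. In terms of a local frame `V_k` of `E`,
`e_i = g^{ki} V_k` where `[g^{jk}]` is the inverse of the matrix `[g (ξ_j, V_k)]`. -/
def dualFrame {r : ℕ} (g : SemiRiemannianMetric n s M) (E : TangentSubspaces n M)
    (ξ : Fin r → VField n M) (i : Fin r) : VField n M := fun x =>
  Classical.epsilon fun e => e ∈ E x ∧ ∀ j, g x e (ξ j x) = if i = j then 1 else 0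

/-- The lightlike vector fields `N_i = e_i - ½ g (e_i, e_j) ξ_j` determined by `ξ` and `E`. -/
def nullFrame {r : ℕ} (g : SemiRiemannianMetric n s M) (E : TangentSubspaces n M)
    (ξ : Fin r → VField n M) (i : Fin r) : VField n M := fun x =>
  dualFrame g E ξ i x
    - (1 / 2 : ℝ) • ∑ j, g x (dualFrame g E ξ i x) (dualFrame g E ξ j x) • ξ j x

/-- The transversal bundle `tr(TF) = ltr(TF) ⊕ S(TF^⊥)`, with `ltr(TF)` spanned by the `N_i`. -/
def transversal {r : ℕ} (g : SemiRiemannianMetric n s M) (S' E : TangentSubspaces n M)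
    (ξ : Fin r → VField n M) : TangentSubspaces n M := fun x =>
  Submodule.span ℝ (range fun i => nullFrame g E ξ i x) ⊔ S' x

/-- `X` is a `C^∞` frame of `D` over `U`, orthonormal in the sense `g (X_a, X_b) = ε_a δ_ab`
with `ε_a = ±1`. -/
structure IsOrthonormalFrameOn (g : SemiRiemannianMetric n s M) (D : TangentSubspaces n M) {k : ℕ}
    (X : Fin k → VField n M) (ε : Fin k → ℝ) (U : Set M) : Prop where
  frame : IsFrameOn D X U
  sign_sq : ∀ a, ε a ^ 2 = 1
  orthonormal : ∀ x ∈ U, ∀ a b, g x (X a x) (X b x) = if a = b then ε a else 0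

/-- `κ` is a `C^∞` differential form of degree one. -/
def IsSmoothOneForm (κ : ∀ x : M, TangentSpace (𝓡 n) x →L[ℝ] ℝ) : Prop :=
  ContMDiff (𝓡 n) ((𝓡 n).prod 𝓘(ℝ, EuclideanSpace ℝ (Fin n) →L[ℝ] ℝ)) ∞
    (fun x => TotalSpace.mk' (EuclideanSpace ℝ (Fin n) →L[ℝ] ℝ)
      (E := fun x : M => TangentSpace (𝓡 n) x →L[ℝ] ℝ) x (κ x))

/-- `κ` vanishes on `TF` and, whatever the local orthonormal frame `X_a` of `S(TF)`, satisfies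
`κ(Z) = λ^i([Z, ξ_i]) + ε^a ω^a([Z, X_a])` for all local sections `Z` of `tr(TF)`, where
`λ^i = g(·, N_i)` and `ω^a = g(·, X_a)`. -/
structure IsKappa {m r : ℕ} (g : SemiRiemannianMetric n s M) (F : Foliation n m M)
    (S S' E : TangentSubspaces n M) (ξ : Fin r → VField n M)
    (κ : ∀ x : M, TangentSpace (𝓡 n) x →L[ℝ] ℝ) : Prop where
  tangent : ∀ x, ∀ v ∈ F.tangent x, κ x v = 0
  transversal : ∀ (U : Set M) (X : Fin (m - r) → VField n M) (ε : Fin (m - r) → ℝ)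
    (Z : VField n M), IsOpen U → IsOrthonormalFrameOn g S X ε U →
    IsSectionOn (transversal g S' E ξ) Z U → ∀ x ∈ U,
      κ x (Z x) = ∑ i, g x (VectorField.mlieBracket (𝓡 n) Z (ξ i) x) (nullFrame g E ξ i x)
        + ∑ a, ε a * g x (VectorField.mlieBracket (𝓡 n) Z (X a) x) (X a x)

/-- The vectors `v_1, …, v_k` form a basis of `W` of orientation `o`. -/
def IsPositive {x : M} {W : Submodule ℝ (TangentSpace (𝓡 n) x)} {k : ℕ}
    (o : Orientation ℝ W (Fin k)) (v : Fin k → TangentSpace (𝓡 n) x) : Prop :=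
  ∃ b : Module.Basis (Fin k) ℝ W,
    (∀ a, (b a : TangentSpace (𝓡 n) x) = v a) ∧ b.orientation = o

/-- `o` is an orientation of the subbundle `S` of rank `k`: the orientations `o x` of the fibres
are locally given by `C^∞` frames. -/
def IsBundleOrientation {k : ℕ} (S : TangentSubspaces n M)
    (o : ∀ x : M, Orientation ℝ (S x) (Fin k)) : Prop :=
  ∀ x : M, ∃ U : Set M, IsOpen U ∧ x ∈ U ∧ ∃ X : Fin k → VField n M,
    IsFrameOn S X U ∧ ∀ y ∈ U, IsPositive (o y) (fun a => X a y)

/-- The exterior product `θ^1 ∧ ⋯ ∧ θ^m` of covectors, with the normalization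
`(θ^1 ∧ ⋯ ∧ θ^m)(Y_1, …, Y_m) = (1 / m!) det [θ^i (Y_j)]`. -/
def wedge {V : Type*} [AddCommGroup V] [Module ℝ V] {m : ℕ} (θ : Fin m → V →ₗ[ℝ] ℝ) :
    V [⋀^Fin m]→ₗ[ℝ] ℝ :=
  (1 / (m.factorial : ℝ)) • Matrix.detRowAlternating.compLinearMap (LinearMap.pi θ)

/-- The `m` covectors `λ^1, …, λ^r, ω^1, …, ω^{m-r}` at `x`. -/
def coframe (m : ℕ) {r : ℕ} (g : SemiRiemannianMetric n s M) (E : TangentSubspaces n M)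
    (ξ : Fin r → VField n M) (X : Fin (m - r) → VField n M) (x : M) :
    Fin m → TangentSpace (𝓡 n) x →ₗ[ℝ] ℝ := fun j =>
  if h : j.val < r then g.covector (nullFrame g E ξ ⟨j, h⟩ x)
  else g.covector (X ⟨j - r, by omega⟩ x)

/-- `χ` is the characteristic form `χ_F = λ^1 ∧ ⋯ ∧ λ^r ∧ χ_S(TF)`, where `χ_S(TF)` is the form
glued from the local forms `ω^1 ∧ ⋯ ∧ ω^{m-r}` of positively oriented orthonormal frames. -/
def IsCharacteristicForm {m r : ℕ} (g : SemiRiemannianMetric n s M) (S E : TangentSubspaces n M)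
    (ξ : Fin r → VField n M) (o : ∀ x : M, Orientation ℝ (S x) (Fin (m - r)))
    (χ : ∀ x : M, TangentSpace (𝓡 n) x [⋀^Fin m]→ₗ[ℝ] ℝ) : Prop :=
  ∀ (U : Set M) (X : Fin (m - r) → VField n M) (ε : Fin (m - r) → ℝ), IsOpen U →
    IsOrthonormalFrameOn g S X ε U → (∀ x ∈ U, IsPositive (o x) (fun a => X a x)) →
    ∀ x ∈ U, χ x = wedge (coframe m g E ξ X x)

/-- `χ` is a `C^∞` differential form of degree `m`. -/
def IsSmoothForm {m : ℕ} (χ : ∀ x : M, TangentSpace (𝓡 n) x [⋀^Fin m]→ₗ[ℝ] ℝ) : Prop :=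
  ∀ (U : Set M) (Y : Fin m → VField n M), IsOpen U → (∀ j, SmoothFieldOn (Y j) U) →
    ContMDiffOn (𝓡 n) 𝓘(ℝ, ℝ) ∞ (fun x => χ x (fun j => Y j x)) U

/-- The Lie derivative `(L_Z χ)(Y_1, …, Y_m)` of a differential form:
`Z(χ(Y_1, …, Y_m)) - ∑_j χ(Y_1, …, [Z, Y_j], …, Y_m)`. -/
def lieDerivative {m : ℕ} (Z : VField n M) (χ : ∀ x : M, TangentSpace (𝓡 n) x [⋀^Fin m]→ₗ[ℝ] ℝ)
    (Y : Fin m → VField n M) (x : M) : ℝ :=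
  (show ℝ from mfderiv (𝓡 n) 𝓘(ℝ, ℝ) (fun y => χ y (fun j => Y j y)) x (Z x))
    - ∑ j, χ x (Function.update (fun k => Y k x) j (VectorField.mlieBracket (𝓡 n) Z (Y j) x))

end Basic

end Lightlike

end

/-!
For a section `Z` of the transversal bundle `tr(TF)`, the number required of `κ(Z)` is the trace of
the part along `TF` of the map `V ↦ [Z, V]`, computed in the frame `ξ_i, X_a` of `TF`; the covectors
`λ^i`, `ε_a ω^a` form the dual frame and vanish on `tr(TF)`. This last fact makes the trace linear
over functions in `Z`, since the derivative terms in `[f Z, V] = f [Z, V] - V(f) Z` are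
annihilated (`bracketTrace_linearCombination`). A change of the orthonormal frame `X` by a
pseudo-orthogonal matrix `A` changes the trace by the logarithmic derivative of `det A = ±1`, which
is zero; concretely, one differentiates `∑ b, ε_b (A a b)^2 = ε'_a`
(`bracketTrace_orthonormalFrame_eq`). Hence, with an orthonormal frame `W` of `S(TF^⊥)`,
`κ = ∑ i, κ(N_i) g(·, ξ_i) + ∑ b, δ_b κ(W_b) g(·, W_b)`
near any point, and this expression (`kappaLocal`) gives existence, uniqueness and smoothness. The
local orthonormal frames come from a Gram–Schmidt process which starts with sections orthonormal at
one point (`exists_orthonormal_sections`).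

Two positively oriented orthonormal frames of `S(TF)` at a point are related by a matrix of positive
determinant whose square is `±1`, hence of determinant `1`, so the characteristic form is well
defined (`wedge_coframe_eq`). For sections `Y_j` of `TF` let `Θ = [θ^i(Y_j)]`, where the `θ^i` are
the covectors `λ^1, …, λ^r, ω^1, …, ω^{m-r}`. Expanding `Y_j` in the frame of `TF` shows
`Z(θ^i(Y_j)) - θ^i([Z, Y_j]) = -(Θ B)_{ji}`, where `B` is the matrix of `V ↦ [Z, V]` in that frame
and has trace `κ(Z)`. By Jacobi's formula the Lie derivative is `-1 / m!` times the sum over `j` of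
the determinants of `Θ` with row `j` replaced by the row of `Θ B`, which is `- tr B · det Θ / m!`
(`mvfderiv_det_metric`, `sum_det_updateRow_mul`).
-/

noncomputable section

namespace Lightlike

section

variable {n : ℕ} {M : Type*} [TopologicalSpace M]
  [ChartedSpace (EuclideanSpace ℝ (Fin n)) M]

/-! ### Smooth vector fields and their brackets -/

section Smooth

variable {U V : Set M} {X Y Z : VField n M} {f : M → ℝ}

theorem mlieBracket_congr (hU : IsOpen U) {x : M} (hx : x ∈ U) {X' Y' : VField n M}
    (hX : ∀ y ∈ U, X y = X' y) (hY : ∀ y ∈ U, Y y = Y' y) :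
    VectorField.mlieBracket (𝓡 n) X Y x = VectorField.mlieBracket (𝓡 n) X' Y' x :=
  Filter.EventuallyEq.mlieBracket_vectorField_eq
    (Filter.eventually_of_mem (hU.mem_nhds hx) hX) (Filter.eventually_of_mem (hU.mem_nhds hx) hY)

variable [IsManifold (𝓡 n) ∞ M] {s : ℕ}

theorem SmoothFieldOn.mono (hX : SmoothFieldOn X U) (h : V ⊆ U) : SmoothFieldOn X V :=
  ContMDiffOn.mono hX h

theorem SmoothFieldOn.sub (hX : SmoothFieldOn X U) (hY : SmoothFieldOn Y U) :
    SmoothFieldOn (fun x => X x - Y x) U :=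
  ContMDiffOn.sub_section hX hY

theorem SmoothFieldOn.smul (hf : ContMDiffOn (𝓡 n) 𝓘(ℝ, ℝ) ∞ f U) (hX : SmoothFieldOn X U) :
    SmoothFieldOn (fun x => f x • X x) U :=
  ContMDiffOn.smul_section hf hX

theorem SmoothFieldOn.sum {ι : Type*} [Fintype ι] {X : ι → VField n M}
    (hX : ∀ i, SmoothFieldOn (X i) U) : SmoothFieldOn (fun x => ∑ i, X i x) U :=
  ContMDiffOn.sum_section fun i _ => hX i

theorem SmoothFieldOn.linearCombination {ι : Type*} [Fintype ι] {X : ι → VField n M}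
    {f : ι → M → ℝ} (hf : ∀ i, ContMDiffOn (𝓡 n) 𝓘(ℝ, ℝ) ∞ (f i) U)
    (hX : ∀ i, SmoothFieldOn (X i) U) : SmoothFieldOn (fun x => ∑ i, f i x • X i x) U :=
  SmoothFieldOn.sum fun i => SmoothFieldOn.smul (hf i) (hX i)

theorem SmoothFieldOn.mdifferentiableAt (hX : SmoothFieldOn X U) (hU : IsOpen U) {x : M}
    (hx : x ∈ U) :
    MDifferentiableAt (𝓡 n) (𝓡 n).tangent (fun x => (⟨x, X x⟩ : TangentBundle (𝓡 n) M)) x :=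
  (ContMDiffOn.contMDiffAt hX (hU.mem_nhds hx)).mdifferentiableAt (by simp)

theorem SmoothFieldOn.mlieBracket (hU : IsOpen U) (hX : SmoothFieldOn X U)
    (hY : SmoothFieldOn Y U) :
    SmoothFieldOn (VectorField.mlieBracket (𝓡 n) X Y) U := by
  intro x hx
  have : IsManifold (𝓡 n) (((⊤ : ℕ∞) : WithTop ℕ∞) + 1) M := by
    change IsManifold (𝓡 n) ∞ M; infer_instance
  have : IsManifold (𝓡 n) (minSmoothness ℝ 2) M := by
    rw [minSmoothness_of_isRCLikeNormedField]
    exact IsManifold.of_le (n := ∞) ENat.LEInfty.out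
  refine ContMDiffAt.contMDiffWithinAt (ContMDiffAt.mlieBracket_vectorField (m := ⊤) (n := ⊤)
    (ContMDiffOn.contMDiffAt hX (hU.mem_nhds hx))
    (ContMDiffOn.contMDiffAt hY (hU.mem_nhds hx)) ?_)
  simp

theorem SemiRiemannianMetric.smooth_apply (g : SemiRiemannianMetric n s M)
    (hX : SmoothFieldOn X U) (hY : SmoothFieldOn Y U) :
    ContMDiffOn (𝓡 n) 𝓘(ℝ, ℝ) ∞ (fun x => g x (X x) (Y x)) U := by
  intro x hx
  have : ContMDiffWithinAt (𝓡 n) ((𝓡 n).prod 𝓘(ℝ)) ∞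
      (fun y => TotalSpace.mk' ℝ (E := Bundle.Trivial M ℝ) y (g y (X y) (Y y))) U x := by
    apply ContMDiffWithinAt.clm_bundle_apply₂ (F₁ := EuclideanSpace ℝ (Fin n))
      (F₂ := EuclideanSpace ℝ (Fin n))
    · exact g.smooth.contMDiffAt.contMDiffWithinAt
    · exact hX x hx
    · exact hY x hx
  simp only [contMDiffWithinAt_totalSpace] at this
  exact this.2

theorem mlieBracket_linearCombination_right {ι : Type*} [Fintype ι] (hU : IsOpen U) {x : M}
    (hx : x ∈ U) {T : ι → VField n M} {f : ι → M → ℝ}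
    (hf : ∀ i, ContMDiffOn (𝓡 n) 𝓘(ℝ, ℝ) ∞ (f i) U) (hT : ∀ i, SmoothFieldOn (T i) U) :
    VectorField.mlieBracket (𝓡 n) Z (fun y => ∑ i, f i y • T i y) x =
      ∑ i, f i x • VectorField.mlieBracket (𝓡 n) Z (T i) x
        + ∑ i, mvfderiv (𝓡 n) (f i) x (Z x) • T i x := by
  classical
  have : IsManifold (𝓡 n) 2 M := IsManifold.of_le (n := ∞) ENat.LEInfty.out
  have key : ∀ A : Finset ι, VectorField.mlieBracket (𝓡 n) Z (fun y => ∑ i ∈ A, f i y • T i y) x =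
      ∑ i ∈ A, f i x • VectorField.mlieBracket (𝓡 n) Z (T i) x
        + ∑ i ∈ A, mvfderiv (𝓡 n) (f i) x (Z x) • T i x := by
    intro A
    induction A using Finset.induction_on with
    | empty =>
      simp only [Finset.sum_empty, add_zero]
      exact congrFun VectorField.mlieBracket_zero_right x
    | insert a A ha ih =>
      have h1 : MDifferentiableAt (𝓡 n) 𝓘(ℝ, ℝ) (f a) x :=
        ((hf a).contMDiffAt (hU.mem_nhds hx)).mdifferentiableAt (by simp)
      have h2 := VectorField.mlieBracket_smul_right (V := Z) h1 ((hT a).mdifferentiableAt hU hx)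
      have h3 := VectorField.mlieBracket_add_right (V := Z) (W := f a • T a)
        (W₁ := fun y => ∑ i ∈ A, f i y • T i y)
        ((SmoothFieldOn.smul (hf a) (hT a)).mdifferentiableAt hU hx)
        (SmoothFieldOn.mdifferentiableAt (U := U)
          (ContMDiffOn.sum_section fun i _ => SmoothFieldOn.smul (hf i) (hT i)) hU hx)
      have h4 : (fun y => ∑ i ∈ insert a A, f i y • T i y)
          = f a • T a + fun y => ∑ i ∈ A, f i y • T i y := by
        ext1 y
        simp [Finset.sum_insert ha]
      rw [h4, h3, h2, ih, Finset.sum_insert ha, Finset.sum_insert ha]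
      abel
  exact key Finset.univ

theorem mlieBracket_linearCombination_left {ι : Type*} [Fintype ι] (hU : IsOpen U) {x : M}
    (hx : x ∈ U) {T : ι → VField n M} {f : ι → M → ℝ}
    (hf : ∀ i, ContMDiffOn (𝓡 n) 𝓘(ℝ, ℝ) ∞ (f i) U) (hT : ∀ i, SmoothFieldOn (T i) U) :
    VectorField.mlieBracket (𝓡 n) (fun y => ∑ i, f i y • T i y) Z x =
      ∑ i, f i x • VectorField.mlieBracket (𝓡 n) (T i) Z x
        - ∑ i, mvfderiv (𝓡 n) (f i) x (Z x) • T i x := by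
  rw [VectorField.mlieBracket_swap_apply, mlieBracket_linearCombination_right hU hx hf hT]
  simp_rw [VectorField.mlieBracket_swap_apply (V := Z) (W := T _)]
  simp only [smul_neg, Finset.sum_neg_distrib]
  abel

end Smooth

end

section

variable {n : ℕ} {M : Type*} [TopologicalSpace M]
  [ChartedSpace (EuclideanSpace ℝ (Fin n)) M]

/-! ### Differentiating sums and determinants -/

section Derivative

variable {U : Set M}

theorem mvfderiv_finset_sum {ι : Type*} {f : ι → M → ℝ} {x : M} (A : Finset ι)
    (hf : ∀ i, MDifferentiableAt (𝓡 n) 𝓘(ℝ, ℝ) (f i) x) :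
    MDifferentiableAt (𝓡 n) 𝓘(ℝ, ℝ) (fun y => ∑ i ∈ A, f i y) x ∧
      ∀ v, mvfderiv (𝓡 n) (fun y => ∑ i ∈ A, f i y) x v = ∑ i ∈ A, mvfderiv (𝓡 n) (f i) x v := by
  classical
  induction A using Finset.induction_on with
  | empty =>
    simp only [Finset.sum_empty]
    exact ⟨mdifferentiableAt_const, fun v => by rw [mvfderiv_const]; rfl⟩
  | insert a A ha ih =>
    have h : (fun y => ∑ i ∈ insert a A, f i y) = f a + fun y => ∑ i ∈ A, f i y := by
      ext1 y
      simp [Finset.sum_insert ha]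
    rw [h]
    refine ⟨(hf a).add ih.1, fun v => ?_⟩
    rw [mvfderiv_add (hf a) ih.1, Finset.sum_insert ha, add_apply, ih.2 v]

theorem mvfderiv_congr_of_isOpen {f f' : M → ℝ} (hU : IsOpen U) {x : M} (hx : x ∈ U)
    (h : ∀ y ∈ U, f y = f' y) : mvfderiv (𝓡 n) f x = mvfderiv (𝓡 n) f' x := by
  have h1 : f =ᶠ[𝓝 x] f' := Filter.eventually_of_mem (hU.mem_nhds hx) h
  ext v
  change (show ℝ from mfderiv (𝓡 n) 𝓘(ℝ, ℝ) f x v) = mfderiv (𝓡 n) 𝓘(ℝ, ℝ) f' x v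
  rw [h1.mfderiv_eq]
  rfl

theorem contMDiffOn_det {ι : Type*} [Fintype ι] [DecidableEq ι] {f : M → Matrix ι ι ℝ}
    (hf : ∀ i j, ContMDiffOn (𝓡 n) 𝓘(ℝ, ℝ) ∞ (fun x => f x i j) U) :
    ContMDiffOn (𝓡 n) 𝓘(ℝ, ℝ) ∞ (fun x => (f x).det) U := by
  simp only [Matrix.det_apply']
  exact contMDiffOn_finsetSum fun σ _ => contMDiffOn_const.mul
    (contMDiffOn_finsetProd fun i _ => hf _ _)

theorem contMDiffOn_inv_matrix {ι : Type*} [Fintype ι] [DecidableEq ι] {f : M → Matrix ι ι ℝ}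
    (hf : ∀ i j, ContMDiffOn (𝓡 n) 𝓘(ℝ, ℝ) ∞ (fun x => f x i j) U)
    (h0 : ∀ x ∈ U, (f x).det ≠ 0) (i j : ι) :
    ContMDiffOn (𝓡 n) 𝓘(ℝ, ℝ) ∞ (fun x => (f x)⁻¹ i j) U := by
  simp only [Matrix.inv_def, Ring.inverse_eq_inv', Matrix.smul_apply, smul_eq_mul,
    Matrix.adjugate_apply]
  refine ((contMDiffOn_det hf).inv₀ h0).mul (contMDiffOn_det fun k l => ?_)
  simp only [Matrix.updateRow_apply]
  split_ifs
  · exact contMDiffOn_const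
  · exact hf k l

/-- Jacobi's formula, in the form `d (det A) = ∑ i, det (A with i-th row replaced by d A_i)`. -/
theorem mvfderiv_det {ι : Type*} [Fintype ι] [DecidableEq ι] {f : M → Matrix ι ι ℝ}
    (hf : ∀ i j, ContMDiffOn (𝓡 n) 𝓘(ℝ, ℝ) ∞ (fun x => f x i j) U) (hU : IsOpen U) {x : M}
    (hx : x ∈ U) (v : TangentSpace (𝓡 n) x) :
    mvfderiv (𝓡 n) (fun y => (f y).det) x v =
      ∑ i, ((f x).updateRow i fun j => mvfderiv (𝓡 n) (fun y => f y i j) x v).det := by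
  let Φ : M → ι → ι → ℝ := fun y i j => f y i j
  have hΦ : MDifferentiableAt (𝓡 n) 𝓘(ℝ, ι → ι → ℝ) Φ x := by
    have : ContMDiffOn (𝓡 n) 𝓘(ℝ, ι → ι → ℝ) ∞ Φ U :=
      contMDiffOn_pi_space.2 fun i => contMDiffOn_pi_space.2 fun j => hf i j
    exact (this.contMDiffAt (hU.mem_nhds hx)).mdifferentiableAt (by simp)
  let D : ContinuousMultilinearMap ℝ (fun _ : ι => ι → ℝ) ℝ :=
    { (Matrix.detRowAlternating (R := ℝ) (n := ι)).toMultilinearMap with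
      cont := Continuous.matrix_det (A := fun B : ι → ι → ℝ => (B : Matrix ι ι ℝ)) continuous_id }
  have hD : HasFDerivAt D (D.linearDeriv (Φ x)) (Φ x) := D.hasFDerivAt (Φ x)
  have hcomp : (fun y => (f y).det) = D ∘ Φ := rfl
  have hentry : ∀ i j, mvfderiv (𝓡 n) (fun y => f y i j) x v
      = (show ι → ι → ℝ from mfderiv (𝓡 n) 𝓘(ℝ, ι → ι → ℝ) Φ x v) i j := by
    intro i j
    let p : (ι → ι → ℝ) →L[ℝ] ℝ :=
      (ContinuousLinearMap.proj (φ := fun _ : ι => ℝ) j).comp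
        (ContinuousLinearMap.proj (φ := fun _ : ι => ι → ℝ) i)
    have := mvfderiv_comp_apply (I := 𝓘(ℝ, ι → ι → ℝ)) (I' := 𝓡 n) (g := p) x p.differentiableAt.mdifferentiableAt hΦ v
    change mvfderiv (𝓡 n) (p ∘ Φ) x v = _
    rw [this]
    change (mfderiv 𝓘(ℝ, ι → ι → ℝ) 𝓘(ℝ, ℝ) p (Φ x)) _ = _
    rw [mfderiv_eq_fderiv, p.fderiv]
    rfl
  rw [hcomp, mvfderiv_comp_apply (I := 𝓘(ℝ, ι → ι → ℝ)) (I' := 𝓡 n) (g := D) x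
    hD.differentiableAt.mdifferentiableAt hΦ v]
  change (mfderiv 𝓘(ℝ, ι → ι → ℝ) 𝓘(ℝ, ℝ) D (Φ x)) _ = _
  rw [mfderiv_eq_fderiv, hD.fderiv]
  change D.linearDeriv (Φ x) (show ι → ι → ℝ from mfderiv (𝓡 n) 𝓘(ℝ, ι → ι → ℝ) Φ x v) = _
  rw [ContinuousMultilinearMap.linearDeriv_apply]
  refine Finset.sum_congr rfl fun i _ => ?_
  simp_rw [hentry]
  rfl

end Derivative

/-- Replacing the rows of `A` one at a time by those of `A * B` multiplies the determinant by the
trace of `B`. -/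
theorem sum_det_updateRow_mul {ι R : Type*} [Fintype ι] [DecidableEq ι] [CommRing R]
    (A B : Matrix ι ι R) :
    ∑ i, (A.updateRow i ((A * B) i)).det = B.trace * A.det := by
  have h : ∀ i, (A.updateRow i ((A * B) i)).det = ((A * B) * A.adjugate) i i := by
    intro i
    rw [← Matrix.det_transpose, ← Matrix.updateCol_transpose, ← Matrix.cramer_apply,
      Matrix.cramer_eq_adjugate_mulVec, ← Matrix.adjugate_transpose, Matrix.mulVec_transpose,
      Matrix.mul_apply]
    rfl
  simp_rw [h]
  change ((A * B) * A.adjugate).trace = _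
  rw [Matrix.trace_mul_comm, ← Matrix.mul_assoc, Matrix.adjugate_mul, Matrix.smul_mul,
    Matrix.one_mul, Matrix.trace_smul, smul_eq_mul, mul_comm]

end

section

/-! ### Orthonormal bases of nondegenerate spaces -/

/-- A nondegenerate symmetric real bilinear form admits a basis with Gram matrix
`diag (±1, …, ±1)`. -/
theorem exists_orthonormal_basis {V : Type*} [AddCommGroup V] [Module ℝ V] [FiniteDimensional ℝ V]
    {k : ℕ} (hk : Module.finrank ℝ V = k) (B : LinearMap.BilinForm ℝ V)
    (hB : ∀ v w, B v w = B w v) (hB0 : ∀ v, (∀ w, B v w = 0) → v = 0) :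
    ∃ (b : Module.Basis (Fin k) ℝ V) (ε : Fin k → ℝ), (∀ a, ε a ^ 2 = 1) ∧
      ∀ a c, B (b a) (b c) = if a = c then ε a else 0 := by
  subst hk
  obtain ⟨v, hv⟩ := LinearMap.BilinForm.exists_orthogonal_basis (B := B) ⟨hB⟩
  have hne : ∀ a, B (v a) (v a) ≠ 0 := by
    intro a h0
    refine v.ne_zero a (hB0 _ fun w => ?_)
    rw [← v.sum_repr w, map_sum]
    refine Finset.sum_eq_zero fun c _ => ?_
    rw [map_smul]
    rcases eq_or_ne a c with rfl | hac
    · rw [h0, smul_zero]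
    · have : B (v a) (v c) = 0 := hv hac
      rw [this, smul_zero]
  have hpos : ∀ a, 0 < |B (v a) (v a)| := fun a => abs_pos.2 (hne a)
  have hsq : ∀ a, √|B (v a) (v a)| ≠ 0 := fun a => (Real.sqrt_pos.2 (hpos a)).ne'
  let u : Fin (Module.finrank ℝ V) → ℝˣ := fun a => (Units.mk0 _ (hsq a))⁻¹
  refine ⟨v.unitsSMul u, fun a => B (v a) (v a) / |B (v a) (v a)|, fun a => ?_, fun a c => ?_⟩
  · rw [div_pow, sq_abs, div_self (pow_ne_zero 2 (hne a))]
  · simp only [Module.Basis.unitsSMul_apply, Units.smul_def, u, Units.val_inv_eq_inv_val,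
      Units.val_mk0, map_smul, LinearMap.smul_apply, smul_eq_mul]
    split_ifs with h
    · subst h
      rw [← mul_assoc, ← mul_inv, Real.mul_self_sqrt (abs_nonneg _), inv_mul_eq_div]
    · have : B (v a) (v c) = 0 := hv h
      rw [this, mul_zero, mul_zero]

variable {n : ℕ} {M : Type*} [TopologicalSpace M]
  [ChartedSpace (EuclideanSpace ℝ (Fin n)) M]

theorem span_eq_of_linearIndependent {x : M} {k : ℕ} {W : Submodule ℝ (TangentSpace (𝓡 n) x)}
    (hW : Module.finrank ℝ W = k) {v : Fin k → TangentSpace (𝓡 n) x} (hv : LinearIndependent ℝ v)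
    (hvW : ∀ a, v a ∈ W) : Submodule.span ℝ (range v) = W := by
  have : FiniteDimensional ℝ (TangentSpace (𝓡 n) x) :=
    inferInstanceAs (FiniteDimensional ℝ (EuclideanSpace ℝ (Fin n)))
  refine Submodule.eq_of_le_of_finrank_eq (Submodule.span_le.2 ?_) ?_
  · rintro _ ⟨a, rfl⟩
    exact hvW a
  · rw [finrank_span_eq_card hv, Fintype.card_fin, hW]

variable [IsManifold (𝓡 n) ∞ M] {s : ℕ}

section Metric

variable (g : SemiRiemannianMetric n s M) {x : M} {ι : Type*} [Fintype ι]

theorem SemiRiemannianMetric.sum_smul_left (c : ι → ℝ) (v : ι → TangentSpace (𝓡 n) x)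
    (w : TangentSpace (𝓡 n) x) : g x (∑ i, c i • v i) w = ∑ i, c i * g x (v i) w := by
  simp only [map_sum, map_smul, sum_apply, smul_apply, smul_eq_mul]

theorem SemiRiemannianMetric.sum_smul_right (c : ι → ℝ) (v : ι → TangentSpace (𝓡 n) x)
    (w : TangentSpace (𝓡 n) x) : g x w (∑ i, c i • v i) = ∑ i, c i * g x w (v i) := by
  simp only [map_sum, map_smul, smul_eq_mul]

variable {g} [DecidableEq ι] {v : ι → TangentSpace (𝓡 n) x} {ε : ι → ℝ}

theorem linearIndependent_of_orthonormal (hε : ∀ a, ε a ^ 2 = 1)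
    (hv : ∀ a b, g x (v a) (v b) = if a = b then ε a else 0) : LinearIndependent ℝ v := by
  rw [Fintype.linearIndependent_iff]
  intro c hc i
  have h := congrArg (fun w => g x w (v i)) hc
  simp only [g.sum_smul_left, hv, map_zero, zero_apply, mul_ite, mul_zero,
    Finset.sum_ite_eq', Finset.mem_univ, if_true] at h
  exact (mul_eq_zero.1 h).resolve_right fun h0 => by simpa [h0] using hε i

/-- The expansion of a vector in an orthonormal basis. -/
theorem eq_sum_of_orthonormal (hε : ∀ a, ε a ^ 2 = 1)
    (hv : ∀ a b, g x (v a) (v b) = if a = b then ε a else 0) {w : TangentSpace (𝓡 n) x}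
    (hw : w ∈ Submodule.span ℝ (range v)) : w = ∑ a, (ε a * g x w (v a)) • v a := by
  obtain ⟨c, rfl⟩ := (Submodule.mem_span_range_iff_exists_fun ℝ).1 hw
  refine Finset.sum_congr rfl fun a _ => ?_
  have : g x (∑ i, c i • v i) (v a) = c a * ε a := by
    simp [hv]
  rw [this]
  congr 1
  linear_combination -c a * hε a

end Metric

theorem IsSubbundle.finrank_eq {D : TangentSubspaces n M} {k : ℕ} (hD : IsSubbundle D k) (x : M) :
    Module.finrank ℝ (D x) = k := by
  obtain ⟨U, -, hx, X, hX⟩ := hD x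
  rw [← hX.span_eq x hx, finrank_span_eq_card (hX.linearIndependent x hx), Fintype.card_fin]

/-! ### Local orthonormal frames -/

section Frames

variable {g : SemiRiemannianMetric n s M} {D : TangentSubspaces n M} {k : ℕ} {U V : Set M}

theorem IsSectionOn.mono {X : VField n M} (hX : IsSectionOn D X U) (h : V ⊆ U) :
    IsSectionOn D X V :=
  ⟨hX.smooth.mono h, fun x hx => hX.mem x (h hx)⟩

theorem IsSectionOn.linearCombination {ι : Type*} [Fintype ι] {X : ι → VField n M}
    {f : ι → M → ℝ} (hf : ∀ i, ContMDiffOn (𝓡 n) 𝓘(ℝ, ℝ) ∞ (f i) U)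
    (hX : ∀ i, IsSectionOn D (X i) U) : IsSectionOn D (fun x => ∑ i, f i x • X i x) U :=
  ⟨SmoothFieldOn.linearCombination hf fun i => (hX i).smooth, fun x hx =>
    Submodule.sum_mem _ fun i _ => Submodule.smul_mem _ _ ((hX i).mem x hx)⟩

theorem IsFrameOn.mono {X : Fin k → VField n M} (hX : IsFrameOn D X U) (h : V ⊆ U) :
    IsFrameOn D X V :=
  ⟨fun a => (hX.smooth a).mono h, fun x hx => hX.linearIndependent x (h hx),
    fun x hx => hX.span_eq x (h hx)⟩

theorem IsFrameOn.isSectionOn {X : Fin k → VField n M} (hX : IsFrameOn D X U) (a : Fin k) :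
    IsSectionOn D (X a) U :=
  ⟨hX.smooth a, fun x hx => hX.span_eq x hx ▸ Submodule.subset_span (mem_range_self a)⟩

theorem IsOrthonormalFrameOn.mono {X : Fin k → VField n M} {ε : Fin k → ℝ}
    (hX : IsOrthonormalFrameOn g D X ε U) (h : V ⊆ U) : IsOrthonormalFrameOn g D X ε V :=
  ⟨hX.frame.mono h, hX.sign_sq, fun x hx => hX.orthonormal x (h hx)⟩

/-- Gram–Schmidt orthonormalization near a point of sections that are orthonormal at that point.
Orthonormality at the point keeps all the norms that occur in the process away from zero,
even though the metric is indefinite. -/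
theorem exists_orthonormal_sections (hU : IsOpen U) {x₀ : M} (hx₀ : x₀ ∈ U)
    (Y : Fin k → VField n M) (hY : ∀ a, IsSectionOn D (Y a) U) (ε : Fin k → ℝ)
    (hε : ∀ a, ε a ^ 2 = 1) (h₀ : ∀ a b, g x₀ (Y a x₀) (Y b x₀) = if a = b then ε a else 0) :
    ∃ V ⊆ U, IsOpen V ∧ x₀ ∈ V ∧ ∃ X : Fin k → VField n M, (∀ a, IsSectionOn D (X a) V) ∧
      (∀ a, X a x₀ = Y a x₀) ∧
      ∀ x ∈ V, ∀ a b, g x (X a x) (X b x) = if a = b then ε a else 0 := by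
  induction k with
  | zero => exact ⟨U, subset_rfl, hU, hx₀, Y, fun a => a.elim0, fun a => a.elim0,
      fun _ _ a => a.elim0⟩
  | succ k ih =>
    obtain ⟨V, hVU, hV, hx₀V, X, hX, hX₀, hXo⟩ := ih (fun a => Y a.castSucc)
      (fun a => hY _) (fun a => ε a.castSucc) (fun a => hε _) fun a b => by
        rw [h₀]; simp [Fin.castSucc_inj]
    let l := Fin.last k
    let c : Fin k → M → ℝ := fun a x => ε a.castSucc * g x (Y l x) (X a x)
    have hc : ∀ a, ContMDiffOn (𝓡 n) 𝓘(ℝ, ℝ) ∞ (c a) V := fun a =>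
      contMDiffOn_const.mul (g.smooth_apply ((hY l).smooth.mono hVU) (hX a).smooth)
    have hsum := IsSectionOn.linearCombination hc hX
    let P : VField n M := fun x => Y l x - ∑ a, c a x • X a x
    have hP : IsSectionOn D P V := ⟨((hY l).smooth.mono hVU).sub hsum.smooth, fun x hx =>
      Submodule.sub_mem _ ((hY l).mem x (hVU hx)) (hsum.mem x hx)⟩
    have hP₀ : P x₀ = Y l x₀ := by
      have : ∀ a, c a x₀ = 0 := fun a => by
        simp only [c, hX₀, h₀, l, if_neg (Fin.castSucc_lt_last a).ne', mul_zero]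
      simp only [P, this, zero_smul, Finset.sum_const_zero, sub_zero]
    have hPX : ∀ x ∈ V, ∀ b, g x (P x) (X b x) = 0 := by
      intro x hx b
      have h1 : g x (∑ a, c a x • X a x) (X b x) = c b x * ε b.castSucc := by
        rw [g.sum_smul_left]
        simp [hXo x hx]
      simp only [P, map_sub, sub_apply, h1, c]
      linear_combination -(g x (Y l x) (X b x)) * hε b.castSucc
    let f : M → ℝ := fun x => ε l * g x (P x) (P x)
    have hf : ContMDiffOn (𝓡 n) 𝓘(ℝ, ℝ) ∞ f V :=
      contMDiffOn_const.mul (g.smooth_apply hP.smooth hP.smooth)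
    have hf₀ : f x₀ = 1 := by
      simp only [f, hP₀, h₀, if_true]
      linear_combination hε l
    let V' : Set M := V ∩ f ⁻¹' Ioi 0
    have hV' : IsOpen V' := hf.continuousOn.isOpen_inter_preimage hV isOpen_Ioi
    let h : M → ℝ := fun x => (√(f x))⁻¹
    have hh : ContMDiffOn (𝓡 n) 𝓘(ℝ, ℝ) ∞ h V' := by
      intro x hx
      have h1 : ContDiffAt ℝ ∞ (fun t : ℝ => (√t)⁻¹) (f x) :=
        (Real.contDiffAt_sqrt (ne_of_gt hx.2)).inv (Real.sqrt_pos.2 hx.2).ne'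
      exact (h1.contMDiffAt (x := f x)).comp_contMDiffWithinAt x
        ((hf x hx.1).mono inter_subset_left)
    have hV'V : V' ⊆ V := inter_subset_left
    let X' : Fin (k + 1) → VField n M := Fin.snoc X fun x => h x • P x
    have e1 : ∀ a : Fin k, X' a.castSucc = X a := fun a => Fin.snoc_castSucc ..
    have e2 : X' (Fin.last k) = fun x => h x • P x := Fin.snoc_last ..
    refine ⟨V', hV'V.trans hVU, hV', ⟨hx₀V, by simp [hf₀]⟩, X', fun a => ?_, fun a => ?_,
      fun x hx a b => ?_⟩
    · induction a using Fin.lastCases with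
      | cast a => rw [e1]; exact (hX a).mono hV'V
      | last =>
        rw [e2]
        exact ⟨SmoothFieldOn.smul hh (hP.smooth.mono hV'V), fun x hx =>
          Submodule.smul_mem _ _ (hP.mem x hx.1)⟩
    · induction a using Fin.lastCases with
      | cast a => rw [e1]; exact hX₀ a
      | last => simp only [e2, h, hf₀, hP₀, Real.sqrt_one, inv_one, one_smul, l]
    · induction a using Fin.lastCases with
      | cast a =>
        induction b using Fin.lastCases with
        | cast b => rw [e1, e1, hXo x hx.1]; simp [Fin.castSucc_inj]
        | last =>
          rw [e1, e2, if_neg (Fin.castSucc_lt_last a).ne]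
          simp only [map_smul]
          rw [g.symm, hPX x hx.1, smul_zero]
      | last =>
        induction b using Fin.lastCases with
        | cast b =>
          rw [e1, e2, if_neg (Fin.castSucc_lt_last b).ne']
          simp only [map_smul, smul_apply]
          rw [hPX x hx.1, smul_zero]
        | last =>
          rw [e2, if_pos rfl]
          simp only [map_smul, smul_apply, smul_eq_mul]
          have hfx : 0 < f x := hx.2
          have h2 : h x * h x * f x = 1 := by
            simp only [h]
            rw [← mul_inv, Real.mul_self_sqrt hfx.le, inv_mul_cancel₀ hfx.ne']
          have h3 : g x (P x) (P x) = ε l * f x := by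
            simp only [f]
            linear_combination -(g x (P x) (P x)) * hε l
          rw [h3]
          linear_combination ε l * h2

/-- An orthonormal basis of a fibre of a subbundle extends to a local orthonormal frame. -/
theorem exists_orthonormalFrame_extending (hD : IsSubbundle D k) {x₀ : M}
    {v : Fin k → TangentSpace (𝓡 n) x₀} (hv : ∀ a, v a ∈ D x₀) {ε : Fin k → ℝ}
    (hε : ∀ a, ε a ^ 2 = 1) (h₀ : ∀ a b, g x₀ (v a) (v b) = if a = b then ε a else 0) :
    ∃ V, IsOpen V ∧ x₀ ∈ V ∧ ∃ X : Fin k → VField n M, IsOrthonormalFrameOn g D X ε V ∧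
      ∀ a, X a x₀ = v a := by
  obtain ⟨U, hU, hx₀, T, hT⟩ := hD x₀
  have h1 : ∀ a, ∃ c : Fin k → ℝ, ∑ i, c i • T i x₀ = v a := fun a =>
    (Submodule.mem_span_range_iff_exists_fun ℝ).1 (hT.span_eq x₀ hx₀ ▸ hv a)
  choose c hc using h1
  obtain ⟨V, -, hV, hxV, X, hX, hX₀, hXo⟩ := exists_orthonormal_sections (g := g) (D := D) hU hx₀
    (fun a x => ∑ i, c a i • T i x)
    (fun a => IsSectionOn.linearCombination (fun i => contMDiffOn_const) hT.isSectionOn) ε hε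
    (by simpa only [hc] using h₀)
  have hli : ∀ x ∈ V, LinearIndependent ℝ fun a => X a x := fun x hx =>
    linearIndependent_of_orthonormal hε (hXo x hx)
  exact ⟨V, hV, hxV, X, ⟨⟨fun a => (hX a).smooth, hli, fun x hx =>
    span_eq_of_linearIndependent (hD.finrank_eq x) (hli x hx) fun a => (hX a).mem x hx⟩, hε, hXo⟩,
    fun a => (hX₀ a).trans (hc a)⟩

theorem exists_orthonormal_basis_fiber (hD : IsSubbundle D k) {x₀ : M}
    (hnd : ∀ v ∈ D x₀, (∀ w ∈ D x₀, g x₀ v w = 0) → v = 0) :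
    ∃ (b : Module.Basis (Fin k) ℝ (D x₀)) (ε : Fin k → ℝ), (∀ a, ε a ^ 2 = 1) ∧
      ∀ a c, g x₀ (b a) (b c) = if a = c then ε a else 0 := by
  have : FiniteDimensional ℝ (TangentSpace (𝓡 n) x₀) :=
    inferInstanceAs (FiniteDimensional ℝ (EuclideanSpace ℝ (Fin n)))
  refine exists_orthonormal_basis (hD.finrank_eq x₀)
    (LinearMap.mk₂ ℝ (fun v w : D x₀ => g x₀ v w) (by simp) (by simp) (by simp) (by simp))
    (fun v w => g.symm x₀ v w) fun v hv => ?_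
  exact Subtype.ext (hnd v v.2 fun w hw => hv ⟨w, hw⟩)

theorem exists_orthonormalFrame (hD : IsSubbundle D k) {x₀ : M}
    (hnd : ∀ v ∈ D x₀, (∀ w ∈ D x₀, g x₀ v w = 0) → v = 0) :
    ∃ V, IsOpen V ∧ x₀ ∈ V ∧ ∃ (X : Fin k → VField n M) (ε : Fin k → ℝ),
      IsOrthonormalFrameOn g D X ε V := by
  obtain ⟨b, ε, hε, hb⟩ := exists_orthonormal_basis_fiber hD hnd
  obtain ⟨V, hV, hx, X, hX, -⟩ := exists_orthonormalFrame_extending hD (fun a => (b a).2) hε hb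
  exact ⟨V, hV, hx, X, ε, hX⟩

end Frames

end

section

variable {n : ℕ} {M : Type*} [TopologicalSpace M]
  [ChartedSpace (EuclideanSpace ℝ (Fin n)) M] [IsManifold (𝓡 n) ∞ M] {s m q r : ℕ}

/-! ### The null frame and the transversal bundle -/

theorem IsOrthonormalFrameOn.isSectionOn_transversal {k : ℕ} {g : SemiRiemannianMetric n s M}
    {S' E : TangentSubspaces n M} {ξ : Fin r → VField n M} {W : Fin k → VField n M}
    {δ : Fin k → ℝ} {U : Set M} (hW : IsOrthonormalFrameOn g S' W δ U) (b : Fin k) :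
    IsSectionOn (transversal g S' E ξ) (W b) U :=
  ⟨hW.frame.smooth b, fun x hx => Submodule.mem_sup_right ((hW.frame.isSectionOn b).mem x hx)⟩

/-- The choices made for a foliation `F` with nontrivial radical distribution: a global frame `ξ`
of `Rad TF`, screen distributions `S ⊆ TF` and `S' ⊆ (TF)^⊥`, and a complement `E` of `Rad TF` in
`S^⊥ ∩ S'^⊥`. -/
structure IsScreenData (q : ℕ) (g : SemiRiemannianMetric n s M) (F : Foliation n m M)
    (ξ : Fin r → VField n M) (S S' E : TangentSubspaces n M) : Prop where
  frame : IsFrameOn (F.radical g) ξ univ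
  screen : IsScreenPair q r g F S S'
  compl : IsRadicalComplement r g F S S' E

namespace IsScreenData

variable {g : SemiRiemannianMetric n s M} {F : Foliation n m M} {ξ : Fin r → VField n M}
  {S S' E : TangentSubspaces n M} (h : IsScreenData q g F ξ S S' E) {x : M} {U : Set M}
include h

theorem dualFrame_spec (i : Fin r) (x : M) :
    dualFrame g E ξ i x ∈ E x ∧
      ∀ j, g x (dualFrame g E ξ i x) (ξ j x) = if i = j then 1 else 0 :=
  Classical.epsilon_spec (existsUnique_dualFrame h.frame h.screen h.compl i x).exists

theorem xi_mem (i : Fin r) (x : M) : ξ i x ∈ F.radical g x :=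
  h.frame.span_eq x (mem_univ x) ▸ Submodule.subset_span (mem_range_self i)

theorem screen_le : S x ≤ F.tangent x :=
  h.screen.screen_compl.sup_eq x ▸ le_sup_left

theorem coscreen_le : S' x ≤ g.orth F.tangent x :=
  h.screen.coscreen_compl.sup_eq x ▸ le_sup_left

theorem xi_apply_tangent (i : Fin r) {v : TangentSpace (𝓡 n) x} (hv : v ∈ F.tangent x) :
    g x (ξ i x) v = 0 :=
  (h.xi_mem i x).2 v hv

theorem xi_apply_normal (i : Fin r) {v : TangentSpace (𝓡 n) x} (hv : v ∈ g.orth F.tangent x) :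
    g x (ξ i x) v = 0 := by
  rw [g.symm]
  exact hv _ (h.xi_mem i x).1

theorem xi_apply_xi (i j : Fin r) : g x (ξ i x) (ξ j x) = 0 :=
  h.xi_apply_tangent i (h.xi_mem j x).1

theorem dualFrame_mem_orth (i : Fin r) : dualFrame g E ξ i x ∈ g.orth S x ⊓ g.orth S' x :=
  h.compl.compl.sup_eq x ▸ Submodule.mem_sup_left (h.dualFrame_spec i x).1

theorem nullFrame_apply_screen (i : Fin r) {v : TangentSpace (𝓡 n) x} (hv : v ∈ S x) :
    g x (nullFrame g E ξ i x) v = 0 := by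
  simp only [nullFrame, map_sub, map_smul, sub_apply, smul_apply, g.sum_smul_left,
    (h.dualFrame_mem_orth i).1 v hv, h.xi_apply_tangent _ (h.screen_le hv)]
  simp

theorem nullFrame_apply_coscreen (i : Fin r) {v : TangentSpace (𝓡 n) x} (hv : v ∈ S' x) :
    g x (nullFrame g E ξ i x) v = 0 := by
  simp only [nullFrame, map_sub, map_smul, sub_apply, smul_apply, g.sum_smul_left,
    (h.dualFrame_mem_orth i).2 v hv, h.xi_apply_normal _ (h.coscreen_le hv)]
  simp

theorem nullFrame_apply_xi (i j : Fin r) :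
    g x (nullFrame g E ξ i x) (ξ j x) = if i = j then 1 else 0 := by
  simp only [nullFrame, map_sub, map_smul, sub_apply, smul_apply, g.sum_smul_left,
    (h.dualFrame_spec i x).2 j, h.xi_apply_xi]
  simp

theorem nullFrame_apply_nullFrame (i j : Fin r) :
    g x (nullFrame g E ξ i x) (nullFrame g E ξ j x) = 0 := by
  rw [nullFrame.eq_def g E ξ j x]
  simp only [map_sub, map_smul, g.sum_smul_right, h.nullFrame_apply_xi]
  simp only [nullFrame, map_sub, map_smul, sub_apply, smul_apply, g.sum_smul_left, smul_eq_mul,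
    g.symm x (ξ _ x), (h.dualFrame_spec _ x).2]
  simp only [mul_ite, mul_one, mul_zero, Finset.sum_ite_eq, Finset.mem_univ, if_true]
  rw [g.symm x (dualFrame g E ξ j x)]
  ring

theorem smooth_dualFrame (i : Fin r) : SmoothFieldOn (dualFrame g E ξ i) univ := by
  intro x₀ _
  obtain ⟨U, hU, hx₀, V, hV⟩ := h.compl.subbundle x₀
  let B : M → Matrix (Fin r) (Fin r) ℝ := fun x => Matrix.of fun k j => g x (V k x) (ξ j x)
  have hB : ∀ k j, ContMDiffOn (𝓡 n) 𝓘(ℝ, ℝ) ∞ (fun x => B x k j) U := fun k j =>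
    g.smooth_apply (hV.smooth k) ((h.frame.smooth j).mono (subset_univ U))
  -- the coefficients of the `e_i` in the frame `V` form the inverse of the matrix `B`
  have hex : ∀ x ∈ U, ∃ C : Matrix (Fin r) (Fin r) ℝ,
      C * B x = 1 ∧ ∀ i, dualFrame g E ξ i x = ∑ k, C i k • V k x := by
    intro x hx
    have h1 : ∀ i, ∃ c : Fin r → ℝ, ∑ k, c k • V k x = dualFrame g E ξ i x := fun i =>
      (Submodule.mem_span_range_iff_exists_fun ℝ).1
        (hV.span_eq x hx ▸ (h.dualFrame_spec i x).1)
    choose c hc using h1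
    refine ⟨Matrix.of c, ?_, fun i => (hc i).symm⟩
    ext i j
    have := (h.dualFrame_spec i x).2 j
    rw [← hc, g.sum_smul_left] at this
    rw [Matrix.mul_apply, Matrix.one_apply, ← this]
    rfl
  have hdet : ∀ x ∈ U, (B x).det ≠ 0 := by
    intro x hx h0
    obtain ⟨C, hC, -⟩ := hex x hx
    have := congrArg Matrix.det hC
    rw [Matrix.det_mul, h0, mul_zero, Matrix.det_one] at this
    exact zero_ne_one this
  have hs : SmoothFieldOn (fun x => ∑ k, (B x)⁻¹ i k • V k x) U :=
    SmoothFieldOn.linearCombination (fun k => contMDiffOn_inv_matrix hB hdet i k) hV.smooth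
  have heq : ∀ x ∈ U, dualFrame g E ξ i x = ∑ k, (B x)⁻¹ i k • V k x := by
    intro x hx
    obtain ⟨C, hC, hC'⟩ := hex x hx
    rw [Matrix.inv_eq_left_inv hC, hC']
  exact ((ContMDiffOn.congr hs fun x hx => by rw [heq x hx]).contMDiffAt
    (hU.mem_nhds hx₀)).contMDiffWithinAt

theorem smooth_nullFrame (i : Fin r) : SmoothFieldOn (nullFrame g E ξ i) univ :=
  (h.smooth_dualFrame i).sub (SmoothFieldOn.smul contMDiffOn_const
    (SmoothFieldOn.linearCombination
      (fun j => g.smooth_apply (h.smooth_dualFrame i) (h.smooth_dualFrame j)) h.frame.smooth))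

theorem nullFrame_isSectionOn (i : Fin r) :
    IsSectionOn (transversal g S' E ξ) (nullFrame g E ξ i) U :=
  ⟨(h.smooth_nullFrame i).mono (subset_univ U), fun _ _ =>
    Submodule.mem_sup_left (Submodule.subset_span (mem_range_self i))⟩

theorem nullFrame_apply_transversal (i : Fin r) {v : TangentSpace (𝓡 n) x}
    (hv : v ∈ transversal g S' E ξ x) : g x v (nullFrame g E ξ i x) = 0 := by
  rw [g.symm]
  obtain ⟨a, ha, b, hb, rfl⟩ := Submodule.mem_sup.1 hv
  obtain ⟨c, rfl⟩ := (Submodule.mem_span_range_iff_exists_fun ℝ).1 ha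
  rw [map_add, h.nullFrame_apply_coscreen i hb, g.sum_smul_right]
  simp [h.nullFrame_apply_nullFrame]

theorem screen_apply_transversal {v w : TangentSpace (𝓡 n) x} (hw : w ∈ S x)
    (hv : v ∈ transversal g S' E ξ x) : g x v w = 0 := by
  obtain ⟨a, ha, b, hb, rfl⟩ := Submodule.mem_sup.1 hv
  obtain ⟨c, rfl⟩ := (Submodule.mem_span_range_iff_exists_fun ℝ).1 ha
  rw [map_add, add_apply, g.sum_smul_left, h.coscreen_le hb w (h.screen_le hw)]
  simp [h.nullFrame_apply_screen _ hw]

theorem screen_nondegenerate (v : TangentSpace (𝓡 n) x) (hv : v ∈ S x)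
    (hv0 : ∀ w ∈ S x, g x v w = 0) : v = 0 := by
  have h1 : v ∈ S x ⊓ F.radical g x := by
    refine ⟨hv, h.screen_le hv, fun w hw => ?_⟩
    rw [← h.screen.screen_compl.sup_eq x] at hw
    obtain ⟨a, ha, b, hb, rfl⟩ := Submodule.mem_sup.1 hw
    rw [map_add, hv0 a ha, g.symm, hb.2 v (h.screen_le hv), add_zero]
  rwa [h.screen.screen_compl.inf_eq x, Submodule.mem_bot] at h1

theorem coscreen_nondegenerate (v : TangentSpace (𝓡 n) x) (hv : v ∈ S' x)
    (hv0 : ∀ w ∈ S' x, g x v w = 0) : v = 0 := by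
  have h1 : v ∈ S' x ⊓ F.radical g x := by
    refine ⟨hv, g.mem_of_orth_orth _ fun w hw => ?_, h.coscreen_le hv⟩
    rw [← h.screen.coscreen_compl.sup_eq x] at hw
    obtain ⟨a, ha, b, hb, rfl⟩ := Submodule.mem_sup.1 hw
    rw [map_add, hv0 a ha, h.coscreen_le hv b hb.1, add_zero]
  rwa [h.screen.coscreen_compl.inf_eq x, Submodule.mem_bot] at h1

/-- Every point has a neighbourhood on which both screen distributions have orthonormal frames. -/
theorem exists_frames (x : M) : ∃ U, IsOpen U ∧ x ∈ U ∧
    ∃ (X : Fin (m - r) → VField n M) (ε : Fin (m - r) → ℝ) (W : Fin (q - r) → VField n M)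
      (δ : Fin (q - r) → ℝ), IsOrthonormalFrameOn g S X ε U ∧ IsOrthonormalFrameOn g S' W δ U := by
  obtain ⟨U, hU, hxU, X, ε, hX⟩ :=
    exists_orthonormalFrame h.screen.screen_subbundle (h.screen_nondegenerate (x := x))
  obtain ⟨V, hV, hxV, W, δ, hW⟩ :=
    exists_orthonormalFrame h.screen.coscreen_subbundle (h.coscreen_nondegenerate (x := x))
  exact ⟨U ∩ V, hU.inter hV, ⟨hxU, hxV⟩, X, ε, W, δ, hX.mono inter_subset_left,
    hW.mono inter_subset_right⟩

section Decomposition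

variable {k : ℕ} {W : Fin k → VField n M} {δ : Fin k → ℝ}
  (hW : IsOrthonormalFrameOn g S' W δ U)
include hW

/-- The sum subtracted here is the projection of `v` to the transversal bundle, parallel to the
leaves. -/
theorem sub_projection_mem_tangent (hx : x ∈ U) (v : TangentSpace (𝓡 n) x) :
    v - (∑ i, g x v (ξ i x) • nullFrame g E ξ i x + ∑ b, (δ b * g x v (W b x)) • W b x)
      ∈ F.tangent x := by
  have hW' : ∀ b, W b x ∈ S' x := fun b => (hW.frame.isSectionOn b).mem x hx
  refine g.mem_of_orth_orth _ fun w hw => ?_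
  rw [← h.screen.coscreen_compl.sup_eq x] at hw
  obtain ⟨a, ha, b, hb, rfl⟩ := Submodule.mem_sup.1 hw
  have h1 : g x (v - (∑ i, g x v (ξ i x) • nullFrame g E ξ i x
      + ∑ b, (δ b * g x v (W b x)) • W b x)) a = 0 := by
    have ha' := ha
    rw [← hW.frame.span_eq x hx] at ha'
    obtain ⟨c, rfl⟩ := (Submodule.mem_span_range_iff_exists_fun ℝ).1 ha'
    have : ∀ b, g x (∑ b, (δ b * g x v (W b x)) • W b x) (W b x) = g x v (W b x) := by
      intro b
      rw [g.sum_smul_left]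
      simp only [hW.orthonormal x hx, mul_ite, mul_zero, Finset.sum_ite_eq', Finset.mem_univ,
        if_true]
      linear_combination g x v (W b x) * hW.sign_sq b
    rw [g.sum_smul_right]
    refine Finset.sum_eq_zero fun b _ => ?_
    rw [map_sub, map_add, sub_apply, add_apply, this, g.sum_smul_left]
    simp [h.nullFrame_apply_coscreen _ (hW' b)]
  have h2 : g x (v - (∑ i, g x v (ξ i x) • nullFrame g E ξ i x
      + ∑ b, (δ b * g x v (W b x)) • W b x)) b = 0 := by
    rw [← h.frame.span_eq x (mem_univ x)] at hb
    obtain ⟨c, rfl⟩ := (Submodule.mem_span_range_iff_exists_fun ℝ).1 hb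
    rw [g.sum_smul_right]
    refine Finset.sum_eq_zero fun j _ => ?_
    rw [map_sub, map_add, sub_apply, add_apply, g.sum_smul_left, g.sum_smul_left]
    simp [h.nullFrame_apply_xi, g.symm x (W _ x),
      h.xi_apply_normal _ (h.coscreen_le (hW' _))]
  rw [map_add, h1, h2, add_zero]

theorem eq_projection_of_mem_transversal (hx : x ∈ U) {v : TangentSpace (𝓡 n) x}
    (hv : v ∈ transversal g S' E ξ x) :
    v = ∑ i, g x v (ξ i x) • nullFrame g E ξ i x + ∑ b, (δ b * g x v (W b x)) • W b x := by
  have hW' : ∀ b, W b x ∈ S' x := fun b => (hW.frame.isSectionOn b).mem x hx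
  obtain ⟨a, ha, b, hb, rfl⟩ := Submodule.mem_sup.1 hv
  have hb' := hb
  rw [← hW.frame.span_eq x hx] at hb'
  obtain ⟨c, rfl⟩ := (Submodule.mem_span_range_iff_exists_fun ℝ).1 ha
  have e1 : ∀ i, g x (∑ i, c i • nullFrame g E ξ i x + b) (ξ i x) = c i := by
    intro i
    rw [map_add, add_apply, g.sum_smul_left, g.symm x b,
      h.xi_apply_normal i (h.coscreen_le hb)]
    simp [h.nullFrame_apply_xi]
  have e2 : ∀ a, g x (∑ i, c i • nullFrame g E ξ i x + b) (W a x) = g x b (W a x) := by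
    intro a
    rw [map_add, add_apply, g.sum_smul_left]
    simp [h.nullFrame_apply_coscreen _ (hW' a)]
  simp only [e1, e2]
  rw [← eq_sum_of_orthonormal (v := fun a => W a x) hW.sign_sq (hW.orthonormal x hx) hb']

end Decomposition

end IsScreenData

end

section

variable {n : ℕ} {M : Type*} [TopologicalSpace M]
  [ChartedSpace (EuclideanSpace ℝ (Fin n)) M] [IsManifold (𝓡 n) ∞ M] {s m q r : ℕ}

/-! ### The mean curvature form -/

/-- The function `∑ i, ε_i g([Z, T_i], P_i)`. When `ε_i P_i` is dual to a frame `T` of a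
distribution, this is the trace of the part along that distribution of the bracket with `Z`. -/
def bracketTrace {ι : Type*} [Fintype ι] (g : SemiRiemannianMetric n s M) (T P : ι → VField n M)
    (ε : ι → ℝ) (Z : VField n M) (x : M) : ℝ :=
  ∑ i, ε i * g x (VectorField.mlieBracket (𝓡 n) Z (T i) x) (P i x)

section BracketTrace

variable {g : SemiRiemannianMetric n s M} {U : Set M} {x : M} {Z : VField n M}

theorem contMDiffOn_bracketTrace {ι : Type*} [Fintype ι] {T P : ι → VField n M} (ε : ι → ℝ)
    (hU : IsOpen U) (hT : ∀ i, SmoothFieldOn (T i) U) (hP : ∀ i, SmoothFieldOn (P i) U)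
    (hZ : SmoothFieldOn Z U) :
    ContMDiffOn (𝓡 n) 𝓘(ℝ, ℝ) ∞ (bracketTrace g T P ε Z) U :=
  contMDiffOn_finsetSum fun i _ => contMDiffOn_const.mul
    (g.smooth_apply (SmoothFieldOn.mlieBracket hU hZ (hT i)) (hP i))

/-- The bracket trace is linear over functions on fields orthogonal to the `P_i`: the derivatives
of the coefficients only contribute multiples of such fields. -/
theorem bracketTrace_linearCombination {ι κ : Type*} [Fintype ι] [Fintype κ]
    {T P : ι → VField n M} (ε : ι → ℝ) (hU : IsOpen U) (hx : x ∈ U) {Y : κ → VField n M}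
    {f : κ → M → ℝ} (hf : ∀ k, ContMDiffOn (𝓡 n) 𝓘(ℝ, ℝ) ∞ (f k) U)
    (hY : ∀ k, SmoothFieldOn (Y k) U) (hYP : ∀ k i, g x (Y k x) (P i x) = 0)
    (hZ : ∀ y ∈ U, Z y = ∑ k, f k y • Y k y) :
    bracketTrace g T P ε Z x = ∑ k, f k x * bracketTrace g T P ε (Y k) x := by
  have h : ∀ i, g x (VectorField.mlieBracket (𝓡 n) Z (T i) x) (P i x)
      = ∑ k, f k x * g x (VectorField.mlieBracket (𝓡 n) (Y k) (T i) x) (P i x) := by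
    intro i
    rw [mlieBracket_congr hU hx hZ fun y _ => rfl, mlieBracket_linearCombination_left hU hx hf hY,
      map_sub, sub_apply, g.sum_smul_left, g.sum_smul_left]
    simp [hYP]
  simp only [bracketTrace, h, Finset.mul_sum]
  rw [Finset.sum_comm]
  exact Finset.sum_congr rfl fun k _ => Finset.sum_congr rfl fun i _ => by ring

/-- The bracket trace of an orthonormal frame does not depend on the frame: the logarithmic
derivative of a pseudo-orthogonal matrix is trace-free. -/
theorem bracketTrace_orthonormalFrame_eq {S : TangentSubspaces n M} {k : ℕ}
    {X X' : Fin k → VField n M} {ε ε' : Fin k → ℝ} (hU : IsOpen U) (hx : x ∈ U)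
    (hX : IsOrthonormalFrameOn g S X ε U) (hX' : IsOrthonormalFrameOn g S X' ε' U) :
    bracketTrace g X' X' ε' Z x = bracketTrace g X X ε Z x := by
  -- `A a b` is the coefficient of `X_b` in `X'_a`
  let A : Fin k → Fin k → M → ℝ := fun a b y => ε b * g y (X' a y) (X b y)
  have hA : ∀ a b, ContMDiffOn (𝓡 n) 𝓘(ℝ, ℝ) ∞ (A a b) U := fun a b =>
    contMDiffOn_const.mul (g.smooth_apply (hX'.frame.smooth a) (hX.frame.smooth b))
  have hexp : ∀ a, ∀ y ∈ U, X' a y = ∑ b, A a b y • X b y := fun a y hy =>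
    eq_sum_of_orthonormal hX.sign_sq (hX.orthonormal y hy)
      (by rw [hX.frame.span_eq y hy]; exact (hX'.frame.isSectionOn a).mem y hy)
  have hexp' : ∀ b, ∀ y ∈ U, X b y = ∑ a, (ε' a * g y (X b y) (X' a y)) • X' a y := fun b y hy =>
    eq_sum_of_orthonormal hX'.sign_sq (hX'.orthonormal y hy)
      (by rw [hX'.frame.span_eq y hy]; exact (hX.frame.isSectionOn b).mem y hy)
  have hXA : ∀ a b, ∀ y ∈ U, g y (X b y) (X' a y) = ε b * A a b y := by
    intro a b y _
    simp only [A]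
    rw [g.symm]
    linear_combination -(g y (X' a y) (X b y)) * hX.sign_sq b
  have hdA : ∀ a b, MDifferentiableAt (𝓡 n) 𝓘(ℝ, ℝ) (A a b) x := fun a b =>
    ((hA a b).contMDiffAt (hU.mem_nhds hx)).mdifferentiableAt (by simp)
  -- differentiating `∑ b, ε_b (A a b)^2 = ε'_a`
  have hder : ∀ a, ∑ b, ε b * (A a b x * mvfderiv (𝓡 n) (A a b) x (Z x)) = 0 := by
    intro a
    let Q : Fin k → M → ℝ := fun b => (fun _ => ε b) * (A a b * A a b)
    have h1 : ∀ y ∈ U, ∑ b, Q b y = ε' a := by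
      intro y hy
      have := hX'.orthonormal y hy a a
      rw [if_pos rfl] at this
      nth_rw 1 [hexp a y hy] at this
      rw [g.sum_smul_left] at this
      rw [← this]
      refine Finset.sum_congr rfl fun b _ => ?_
      rw [hXA a b y hy]
      simp only [Q, Pi.mul_apply]
      ring
    have h2 := mvfderiv_congr_of_isOpen (n := n) hU hx h1
    have h3 : ∀ b, MDifferentiableAt (𝓡 n) 𝓘(ℝ, ℝ) (Q b) x :=
      fun b => mdifferentiableAt_const.mul ((hdA a b).mul (hdA a b))
    have h4 := (mvfderiv_finset_sum Finset.univ h3).2 (Z x)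
    rw [h2, mvfderiv_const] at h4
    have h5 : ∀ b, mvfderiv (𝓡 n) (Q b) x (Z x)
        = 2 * (ε b * (A a b x * mvfderiv (𝓡 n) (A a b) x (Z x))) := by
      intro b
      simp only [Q]
      rw [mvfderiv_mul mdifferentiableAt_const ((hdA a b).mul (hdA a b)),
        mvfderiv_mul (hdA a b) (hdA a b), mvfderiv_const]
      simp
      ring
    simp only [h5, ← Finset.mul_sum] at h4
    have h6 : (0 : ℝ) = 2 * ∑ b, ε b * (A a b x * mvfderiv (𝓡 n) (A a b) x (Z x)) := h4
    linarith
  have hterm : ∀ a, g x (VectorField.mlieBracket (𝓡 n) Z (X' a) x) (X' a x)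
      = ∑ b, A a b x * g x (VectorField.mlieBracket (𝓡 n) Z (X b) x) (X' a x) := by
    intro a
    rw [mlieBracket_congr hU hx (fun y _ => rfl) (hexp a),
      mlieBracket_linearCombination_right hU hx (hA a) hX.frame.smooth,
      map_add, add_apply, g.sum_smul_left, g.sum_smul_left, add_eq_left, ← hder a]
    refine Finset.sum_congr rfl fun b _ => ?_
    rw [hXA a b x hx]
    ring
  simp only [bracketTrace, hterm, Finset.mul_sum]
  rw [Finset.sum_comm]
  refine Finset.sum_congr rfl fun b _ => ?_
  have hb := congrArg (g x (VectorField.mlieBracket (𝓡 n) Z (X b) x)) (hexp' b x hx)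
  rw [g.sum_smul_right] at hb
  rw [hb, Finset.mul_sum]
  refine Finset.sum_congr rfl fun a _ => ?_
  rw [hXA a b x hx]
  linear_combination -(ε' a * A a b x
    * g x (VectorField.mlieBracket (𝓡 n) Z (X b) x) (X' a x)) * hX.sign_sq b

end BracketTrace

section Kappa

variable {g : SemiRiemannianMetric n s M} {F : Foliation n m M} {ξ : Fin r → VField n M}
  {S S' E : TangentSubspaces n M}

/-- The value `∑ i, λ^i([Z, ξ_i]) + ∑ a, ε_a ω^a([Z, X_a])` prescribed for `κ(Z)`. -/
def kappaTrace {k : ℕ} (g : SemiRiemannianMetric n s M) (E : TangentSubspaces n M)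
    (ξ : Fin r → VField n M) (X : Fin k → VField n M) (ε : Fin k → ℝ) (Z : VField n M)
    (x : M) : ℝ :=
  bracketTrace g ξ (nullFrame g E ξ) (fun _ => 1) Z x + bracketTrace g X X ε Z x

theorem kappaTrace_eq {k : ℕ} (X : Fin k → VField n M) (ε : Fin k → ℝ) (Z : VField n M) (x : M) :
    kappaTrace g E ξ X ε Z x =
      ∑ i, g x (VectorField.mlieBracket (𝓡 n) Z (ξ i) x) (nullFrame g E ξ i x)
        + ∑ a, ε a * g x (VectorField.mlieBracket (𝓡 n) Z (X a) x) (X a x) := by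
  simp only [kappaTrace, bracketTrace, one_mul]

/-- The expression of `κ` in orthonormal frames `X` of `S(TF)` and `W` of `S(TF^⊥)`: the values of
`κ` on the frame `N_i, W_b` of `tr(TF)`, multiplied by the covectors of the dual frame, all of
which vanish on `TF`. -/
def kappaLocal {k l : ℕ} (g : SemiRiemannianMetric n s M) (E : TangentSubspaces n M)
    (ξ : Fin r → VField n M) (X : Fin k → VField n M) (ε : Fin k → ℝ) (W : Fin l → VField n M)
    (δ : Fin l → ℝ) (x : M) : TangentSpace (𝓡 n) x →L[ℝ] ℝ :=
  ∑ i, kappaTrace g E ξ X ε (nullFrame g E ξ i) x • g x (ξ i x)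
    + ∑ b, (δ b * kappaTrace g E ξ X ε (W b) x) • g x (W b x)

theorem kappaLocal_apply {k l : ℕ} (X : Fin k → VField n M) (ε : Fin k → ℝ)
    (W : Fin l → VField n M) (δ : Fin l → ℝ) (x : M) (v : TangentSpace (𝓡 n) x) :
    kappaLocal g E ξ X ε W δ x v =
      ∑ i, g x v (ξ i x) * kappaTrace g E ξ X ε (nullFrame g E ξ i) x
        + ∑ b, (δ b * g x v (W b x)) * kappaTrace g E ξ X ε (W b) x := by
  simp only [kappaLocal, add_apply, sum_apply, smul_apply, smul_eq_mul, g.symm x v]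
  congr 1 <;> exact Finset.sum_congr rfl fun i _ => by ring

namespace IsScreenData

variable (h : IsScreenData q g F ξ S S' E) {x : M} {U : Set M} {X : Fin (m - r) → VField n M}
  {ε : Fin (m - r) → ℝ} {l : ℕ} {W : Fin l → VField n M} {δ : Fin l → ℝ}
include h

theorem contMDiffOn_kappaTrace (hU : IsOpen U) (hX : IsOrthonormalFrameOn g S X ε U)
    {Z : VField n M} (hZ : SmoothFieldOn Z U) :
    ContMDiffOn (𝓡 n) 𝓘(ℝ, ℝ) ∞ (kappaTrace g E ξ X ε Z) U :=
  (contMDiffOn_bracketTrace _ hU (fun i => (h.frame.smooth i).mono (subset_univ U))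
    (fun i => (h.smooth_nullFrame i).mono (subset_univ U)) hZ).add
    (contMDiffOn_bracketTrace _ hU hX.frame.smooth hX.frame.smooth hZ)

/-- On sections of the transversal bundle, the prescribed value is given by the local expression
of `κ`. -/
theorem kappaTrace_eq_kappaLocal (hU : IsOpen U) (hx : x ∈ U)
    (hX : IsOrthonormalFrameOn g S X ε U) (hW : IsOrthonormalFrameOn g S' W δ U) {Z : VField n M}
    (hZ : IsSectionOn (transversal g S' E ξ) Z U) :
    kappaTrace g E ξ X ε Z x = kappaLocal g E ξ X ε W δ x (Z x) := by
  let Y : Fin r ⊕ Fin l → VField n M := Sum.elim (nullFrame g E ξ) W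
  let f : Fin r ⊕ Fin l → M → ℝ :=
    Sum.elim (fun i y => g y (Z y) (ξ i y)) fun b y => δ b * g y (Z y) (W b y)
  have hY : ∀ j, IsSectionOn (transversal g S' E ξ) (Y j) U := by
    rintro (i | b)
    · exact h.nullFrame_isSectionOn i
    · exact hW.isSectionOn_transversal b
  have hf : ∀ j, ContMDiffOn (𝓡 n) 𝓘(ℝ, ℝ) ∞ (f j) U := by
    rintro (i | b)
    · exact g.smooth_apply hZ.smooth ((h.frame.smooth i).mono (subset_univ U))
    · exact contMDiffOn_const.mul (g.smooth_apply hZ.smooth (hW.frame.smooth b))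
  have hexp : ∀ y ∈ U, Z y = ∑ j, f j y • Y j y := by
    intro y hy
    rw [Fintype.sum_sum_type]
    exact h.eq_projection_of_mem_transversal hW hy (hZ.mem y hy)
  rw [kappaTrace, bracketTrace_linearCombination _ hU hx hf (fun j => (hY j).smooth)
      (fun j i => h.nullFrame_apply_transversal i ((hY j).mem x hx)) hexp,
    bracketTrace_linearCombination _ hU hx hf (fun j => (hY j).smooth)
      (fun j a => h.screen_apply_transversal ((hX.frame.isSectionOn a).mem x hx)
        ((hY j).mem x hx)) hexp,
    ← Finset.sum_add_distrib, Fintype.sum_sum_type, kappaLocal_apply]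
  simp only [kappaTrace, mul_add]
  rfl

/-- The defining properties of `κ` determine it: in orthonormal frames it is given by the local
expression. -/
theorem eq_kappaLocal_of_isKappa {κ : ∀ x : M, TangentSpace (𝓡 n) x →L[ℝ] ℝ}
    (hκ : IsKappa g F S S' E ξ κ) (hU : IsOpen U) (hx : x ∈ U)
    (hX : IsOrthonormalFrameOn g S X ε U) (hW : IsOrthonormalFrameOn g S' W δ U) :
    κ x = kappaLocal g E ξ X ε W δ x := by
  ext v
  have h0 := hκ.tangent x _ (h.sub_projection_mem_tangent hW hx v)
  rw [map_sub, sub_eq_zero] at h0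
  have h1 : ∀ i, κ x (nullFrame g E ξ i x) = kappaTrace g E ξ X ε (nullFrame g E ξ i) x :=
    fun i => (hκ.transversal U X ε _ hU hX (h.nullFrame_isSectionOn i) x hx).trans
      (kappaTrace_eq ..).symm
  have h2 : ∀ b, κ x (W b x) = kappaTrace g E ξ X ε (W b) x :=
    fun b => (hκ.transversal U X ε _ hU hX (hW.isSectionOn_transversal b) x hx).trans
      (kappaTrace_eq ..).symm
  rw [h0, kappaLocal_apply, map_add, map_sum, map_sum]
  simp only [map_smul, smul_eq_mul, h1, h2]

theorem kappaLocal_apply_tangent (hx : x ∈ U) (hW : IsOrthonormalFrameOn g S' W δ U)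
    {v : TangentSpace (𝓡 n) x} (hv : v ∈ F.tangent x) : kappaLocal g E ξ X ε W δ x v = 0 := by
  have h1 : ∀ i, g x v (ξ i x) = 0 := fun i => by rw [g.symm, h.xi_apply_tangent i hv]
  have h2 : ∀ b, g x v (W b x) = 0 := fun b => by
    rw [g.symm, h.coscreen_le ((hW.frame.isSectionOn b).mem x hx) v hv]
  simp [kappaLocal_apply, h1, h2]

theorem exists_isKappa : ∃ κ : ∀ x : M, TangentSpace (𝓡 n) x →L[ℝ] ℝ,
    IsKappa g F S S' E ξ κ := by
  choose V hV hxV X ε W δ hX hW using h.exists_frames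
  refine ⟨fun x => kappaLocal g E ξ (X x) (ε x) (W x) (δ x) x,
    fun x v hv => h.kappaLocal_apply_tangent (hxV x) (hW x) hv, ?_⟩
  intro U X' ε' Z hU hX' hZ x hx
  have hUV : IsOpen (U ∩ V x) := hU.inter (hV x)
  have hx' : x ∈ U ∩ V x := ⟨hx, hxV x⟩
  rw [← kappaTrace_eq, ← h.kappaTrace_eq_kappaLocal hUV hx' ((hX x).mono inter_subset_right)
    ((hW x).mono inter_subset_right) (hZ.mono inter_subset_left), kappaTrace, kappaTrace,
    bracketTrace_orthonormalFrame_eq hUV hx' ((hX x).mono inter_subset_right)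
      (hX'.mono inter_subset_left)]

theorem contMDiffOn_kappaLocal (hU : IsOpen U) (hX : IsOrthonormalFrameOn g S X ε U)
    (hW : IsOrthonormalFrameOn g S' W δ U) :
    ContMDiffOn (𝓡 n) ((𝓡 n).prod 𝓘(ℝ, EuclideanSpace ℝ (Fin n) →L[ℝ] ℝ)) ∞
      (fun x => TotalSpace.mk' (EuclideanSpace ℝ (Fin n) →L[ℝ] ℝ)
        (E := fun x : M => TangentSpace (𝓡 n) x →L[ℝ] ℝ) x (kappaLocal g E ξ X ε W δ x)) U := by
  have hcov : ∀ {Y : VField n M}, SmoothFieldOn Y U →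
      ContMDiffOn (𝓡 n) ((𝓡 n).prod 𝓘(ℝ, EuclideanSpace ℝ (Fin n) →L[ℝ] ℝ)) ∞
        (fun x => TotalSpace.mk' (EuclideanSpace ℝ (Fin n) →L[ℝ] ℝ)
          (E := fun x : M => TangentSpace (𝓡 n) x →L[ℝ] ℝ) x (g x (Y x))) U := fun hY =>
    ContMDiffOn.clm_bundle_apply (E₂ := fun x : M => TangentSpace (𝓡 n) x →L[ℝ] ℝ)
      g.smooth.contMDiffOn hY
  refine ContMDiffOn.add_section (V := fun x : M => TangentSpace (𝓡 n) x →L[ℝ] ℝ)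
    (ContMDiffOn.sum_section (V := fun x : M => TangentSpace (𝓡 n) x →L[ℝ] ℝ) fun i _ =>
      ContMDiffOn.smul_section (V := fun x : M => TangentSpace (𝓡 n) x →L[ℝ] ℝ)
        (h.contMDiffOn_kappaTrace hU hX ((h.smooth_nullFrame i).mono (subset_univ U)))
        (hcov ((h.frame.smooth i).mono (subset_univ U))))
    (ContMDiffOn.sum_section (V := fun x : M => TangentSpace (𝓡 n) x →L[ℝ] ℝ) fun b _ =>
      ContMDiffOn.smul_section (V := fun x : M => TangentSpace (𝓡 n) x →L[ℝ] ℝ)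
        (contMDiffOn_const.mul (h.contMDiffOn_kappaTrace hU hX (hW.frame.smooth b)))
        (hcov (hW.frame.smooth b)))

theorem isSmoothOneForm_of_isKappa {κ : ∀ x : M, TangentSpace (𝓡 n) x →L[ℝ] ℝ}
    (hκ : IsKappa g F S S' E ξ κ) : IsSmoothOneForm κ := by
  intro x
  obtain ⟨U, hU, hxU, X, ε, W, δ, hX, hW⟩ := h.exists_frames x
  exact ((h.contMDiffOn_kappaLocal hU hX hW).congr fun y hy => by
    rw [h.eq_kappaLocal_of_isKappa hκ hU hy hX hW]).contMDiffAt (hU.mem_nhds hxU)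

theorem isKappa_unique {κ κ' : ∀ x : M, TangentSpace (𝓡 n) x →L[ℝ] ℝ}
    (hκ : IsKappa g F S S' E ξ κ) (hκ' : IsKappa g F S S' E ξ κ') : κ' = κ := by
  funext x
  obtain ⟨U, hU, hxU, X, ε, W, δ, hX, hW⟩ := h.exists_frames x
  rw [h.eq_kappaLocal_of_isKappa hκ hU hxU hX hW, h.eq_kappaLocal_of_isKappa hκ' hU hxU hX hW]

end IsScreenData

end Kappa

end

section

/-! ### The characteristic form -/

theorem wedge_apply {V : Type*} [AddCommGroup V] [Module ℝ V] {m : ℕ} (θ : Fin m → V →ₗ[ℝ] ℝ)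
    (v : Fin m → V) :
    wedge θ v = 1 / (m.factorial : ℝ) * (Matrix.of fun j i => θ i (v j)).det := rfl

/-- The index set of `λ^1, …, λ^r, ω^1, …, ω^{m-r}`, split into its two parts. -/
def frameIndex {r m : ℕ} (h : r ≤ m) : Fin r ⊕ Fin (m - r) ≃ Fin m :=
  finSumFinEquiv.trans (finCongr (by omega))

variable {n : ℕ} {M : Type*} [TopologicalSpace M]
  [ChartedSpace (EuclideanSpace ℝ (Fin n)) M] [IsManifold (𝓡 n) ∞ M] {s m q r : ℕ}

section Coframe

variable (g : SemiRiemannianMetric n s M) (E : TangentSubspaces n M) (ξ : Fin r → VField n M)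
  (X : Fin (m - r) → VField n M)

/-- The vector fields `N_1, …, N_r, X_1, …, X_{m-r}` metrically equivalent to the coframe. -/
def coframeField (h : r ≤ m) (j : Fin m) : VField n M :=
  Sum.elim (nullFrame g E ξ) X ((frameIndex h).symm j)

theorem coframe_apply (h : r ≤ m) (j : Fin m) (x : M) (v : TangentSpace (𝓡 n) x) :
    coframe m g E ξ X x j v = g x v (coframeField g E ξ X h j x) := by
  obtain ⟨i | a, rfl⟩ := (frameIndex h).surjective j
  · have : (frameIndex h (Sum.inl i)).val = i.val := rfl
    simp only [coframeField, Equiv.symm_apply_apply, Sum.elim_inl, coframe]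
    rw [dif_pos (by rw [this]; exact i.2)]
    rfl
  · have : (frameIndex h (Sum.inr a)).val = r + a.val := rfl
    simp only [coframeField, Equiv.symm_apply_apply, Sum.elim_inr, coframe]
    rw [dif_neg (by omega)]
    have e : (⟨(frameIndex h (Sum.inr a)).val - r, by omega⟩ : Fin (m - r)) = a :=
      Fin.ext (by simp [this])
    rw [e]
    rfl

theorem wedge_coframe_apply (h : r ≤ m) (x : M) (v : Fin m → TangentSpace (𝓡 n) x) :
    wedge (coframe m g E ξ X x) v = 1 / (m.factorial : ℝ)
      * (Matrix.of fun j i => g x (v j) (coframeField g E ξ X h i x)).det := by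
  simp only [wedge_apply, coframe_apply g E ξ X h]

end Coframe

/-- Two orthonormal bases defining the same orientation have change of basis matrix of
determinant `1`. -/
theorem det_toMatrix_orthonormal {V : Type*} [AddCommGroup V] [Module ℝ V] {k : ℕ}
    (B : LinearMap.BilinForm ℝ V) {b b' : Module.Basis (Fin k) ℝ V} {ε ε' : Fin k → ℝ}
    (hε : ∀ a, ε a ^ 2 = 1) (hε' : ∀ a, ε' a ^ 2 = 1)
    (hb : ∀ a c, B (b a) (b c) = if a = c then ε a else 0)
    (hb' : ∀ a c, B (b' a) (b' c) = if a = c then ε' a else 0)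
    (ho : b.orientation = b'.orientation) : (b.toMatrix b').det = 1 := by
  have hpos : 0 < (b.toMatrix b').det := by
    have := (b.orientation_eq_iff_det_pos b').1 ho
    rwa [Module.Basis.det_apply] at this
  have hd : ∀ {c : Module.Basis (Fin k) ℝ V} {η : Fin k → ℝ},
      (∀ a d, B (c a) (c d) = if a = d then η a else 0) →
      LinearMap.BilinForm.toMatrix c B = Matrix.diagonal η := by
    intro c η hc
    ext i j
    rw [LinearMap.BilinForm.toMatrix_apply, hc, Matrix.diagonal_apply]
  have h1 := LinearMap.BilinForm.toMatrix_mul_basis_toMatrix b b' B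
  rw [hd hb, hd hb'] at h1
  have h2 := congrArg (fun A : Matrix (Fin k) (Fin k) ℝ => A.det ^ 2) h1
  simp only [Matrix.det_mul, Matrix.det_transpose, Matrix.det_diagonal, mul_pow,
    ← Finset.prod_pow, hε, hε', Finset.prod_const_one, mul_one] at h2
  have h3 : ((b.toMatrix b').det ^ 2) ^ 2 = 1 := by linear_combination h2
  have h4 := (pow_eq_one_iff_of_nonneg (sq_nonneg _) two_ne_zero).1 h3
  exact (pow_eq_one_iff_of_nonneg hpos.le two_ne_zero).1 h4

section Wedge

variable {g : SemiRiemannianMetric n s M} {S E : TangentSubspaces n M} {ξ : Fin r → VField n M}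
  {U U' : Set M} {X X' : Fin (m - r) → VField n M} {ε ε' : Fin (m - r) → ℝ} {x : M}

theorem contMDiffOn_wedge_coframe (h : r ≤ m) (hN : ∀ i, SmoothFieldOn (nullFrame g E ξ i) univ)
    (hX : ∀ a, SmoothFieldOn (X a) U) {Y : Fin m → VField n M} (hY : ∀ j, SmoothFieldOn (Y j) U) :
    ContMDiffOn (𝓡 n) 𝓘(ℝ, ℝ) ∞ (fun x => wedge (coframe m g E ξ X x) fun j => Y j x) U := by
  simp only [wedge_coframe_apply g E ξ X h]
  refine contMDiffOn_const.mul (contMDiffOn_det fun j i => g.smooth_apply (hY j) ?_)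
  rcases hi : (frameIndex h).symm i with k | k
  · simp only [coframeField, hi]; exact (hN k).mono (subset_univ U)
  · simp only [coframeField, hi]; exact hX k

/-- The form `λ^1 ∧ ⋯ ∧ λ^r ∧ ω^1 ∧ ⋯ ∧ ω^{m-r}` is the same for all positively oriented
orthonormal frames. -/
theorem wedge_coframe_eq (h : r ≤ m) {o : Orientation ℝ (S x) (Fin (m - r))}
    (hX : IsOrthonormalFrameOn g S X ε U) (hX' : IsOrthonormalFrameOn g S X' ε' U')
    (hx : x ∈ U) (hx' : x ∈ U') (ho : IsPositive o fun a => X a x)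
    (ho' : IsPositive o fun a => X' a x) :
    wedge (coframe m g E ξ X' x) = wedge (coframe m g E ξ X x) := by
  obtain ⟨b, hb, rfl⟩ := ho
  obtain ⟨b', hb', hbb'⟩ := ho'
  let B : LinearMap.BilinForm ℝ (S x) :=
    LinearMap.mk₂ ℝ (fun v w : S x => g x v w) (by simp) (by simp) (by simp) (by simp)
  have hdet := det_toMatrix_orthonormal B hX.sign_sq hX'.sign_sq (b := b) (b' := b')
    (fun a c => by
      change g x (b a) (b c) = _
      rw [hb, hb]; exact hX.orthonormal x hx a c)
    (fun a c => by
      change g x (b' a) (b' c) = _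
      rw [hb', hb']; exact hX'.orthonormal x hx' a c) hbb'.symm
  set A := b.toMatrix b' with hA
  have hexp : ∀ a, X' a x = ∑ c, A c a • X c x := by
    intro a
    have h1 := congrArg (Submodule.subtype (S x)) (b.sum_toMatrix_smul_self b' a)
    rw [map_sum] at h1
    simp only [map_smul, Submodule.subtype_apply, hb, hb'] at h1
    exact h1.symm
  ext v
  rw [wedge_coframe_apply g E ξ X h, wedge_coframe_apply g E ξ X' h]
  congr 1
  rw [← Matrix.det_submatrix_equiv_self (frameIndex h), ←
    Matrix.det_submatrix_equiv_self (frameIndex h) (Matrix.of _)]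
  have hmul : (Matrix.of fun j i => g x (v j) (coframeField g E ξ X' h i x)).submatrix
      (frameIndex h) (frameIndex h) =
      (Matrix.of fun j i => g x (v j) (coframeField g E ξ X h i x)).submatrix
        (frameIndex h) (frameIndex h) * Matrix.fromBlocks 1 0 0 A := by
    ext j (i | a)
    · simp [Matrix.mul_apply, coframeField, Fintype.sum_sum_type, Matrix.one_apply]
    · simp [Matrix.mul_apply, coframeField, Fintype.sum_sum_type, hexp, mul_comm]
  rw [hmul, Matrix.det_mul, Matrix.det_fromBlocks_zero₂₁, hdet, Matrix.det_one, mul_one, mul_one]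

end Wedge

/-- Every point has a neighbourhood on which the oriented bundle `S` has a positively oriented
orthonormal frame. -/
theorem exists_positive_orthonormalFrame {g : SemiRiemannianMetric n s M}
    {S : TangentSubspaces n M} {k : ℕ} (hk : 0 < k) (hS : IsSubbundle S k)
    {o : ∀ x : M, Orientation ℝ (S x) (Fin k)} (ho : IsBundleOrientation S o) {x₀ : M}
    (hnd : ∀ v ∈ S x₀, (∀ w ∈ S x₀, g x₀ v w = 0) → v = 0) :
    ∃ V, IsOpen V ∧ x₀ ∈ V ∧ ∃ (X : Fin k → VField n M) (ε : Fin k → ℝ),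
      IsOrthonormalFrameOn g S X ε V ∧ ∀ x ∈ V, IsPositive (o x) fun a => X a x := by
  have : Nonempty (Fin k) := ⟨⟨0, hk⟩⟩
  obtain ⟨b₀, ε, hε, hb₀⟩ := exists_orthonormal_basis_fiber hS hnd
  -- changing the sign of a basis vector adjusts the orientation at `x₀`
  let b := b₀.adjustToOrientation (o x₀)
  have hb : ∀ a c, g x₀ (b a) (b c) = if a = c then ε a else 0 := by
    intro a c
    by_cases hac : a = c
    · subst hac
      rw [← hb₀]
      rcases b₀.adjustToOrientation_apply_eq_or_eq_neg (o x₀) a with h | h <;> simp [b, h]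
    · rw [← hb₀]
      rcases b₀.adjustToOrientation_apply_eq_or_eq_neg (o x₀) a with h | h <;>
      rcases b₀.adjustToOrientation_apply_eq_or_eq_neg (o x₀) c with h' | h' <;>
      simp [b, h, h', hb₀, hac]
  have hbo : b.orientation = o x₀ := b₀.orientation_adjustToOrientation (o x₀)
  obtain ⟨V, hV, hxV, X, hX, hX₀⟩ :=
    exists_orthonormalFrame_extending hS (fun a => (b a).2) hε hb
  obtain ⟨U, hU, hxU, T, hT, hTo⟩ := ho x₀
  -- the determinant of the frame `T`, positively oriented on all of `U`, relative to `X`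
  let f : M → ℝ := fun x => (Matrix.of fun a c => ε a * g x (T c x) (X a x)).det
  have hf : ContMDiffOn (𝓡 n) 𝓘(ℝ, ℝ) ∞ f (V ∩ U) := contMDiffOn_det fun a c =>
    contMDiffOn_const.mul (g.smooth_apply ((hT.smooth c).mono inter_subset_right)
      ((hX.frame.smooth a).mono inter_subset_left))
  have hfo : ∀ x ∈ V ∩ U, ∀ e : Module.Basis (Fin k) ℝ (S x),
      (∀ a, (e a : TangentSpace (𝓡 n) x) = X a x) → (e.orientation = o x ↔ 0 < f x) := by
    intro x hx e he
    obtain ⟨t, ht, hto⟩ := hTo x hx.2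
    have hmat : e.toMatrix t = Matrix.of fun a c => ε a * g x (T c x) (X a x) := by
      ext a c
      have hsum := congrArg (Submodule.subtype (S x)) (e.sum_toMatrix_smul_self t c)
      rw [map_sum] at hsum
      simp only [map_smul, Submodule.subtype_apply, he, ht] at hsum
      rw [Matrix.of_apply, ← hsum, g.sum_smul_left]
      simp only [hX.orthonormal x hx.1, mul_ite, mul_zero, Finset.sum_ite_eq', Finset.mem_univ,
        if_true]
      linear_combination -(e.toMatrix t a c) * hε a
    rw [← hto, e.orientation_eq_iff_det_pos t, Module.Basis.det_apply, hmat]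
  have hf₀ : 0 < f x₀ := (hfo x₀ ⟨hxV, hxU⟩ b fun a => (hX₀ a).symm).1 hbo
  let V' : Set M := (V ∩ U) ∩ f ⁻¹' Ioi 0
  have hV' : IsOpen V' :=
    hf.continuousOn.isOpen_inter_preimage (hV.inter hU) isOpen_Ioi
  refine ⟨V', hV', ⟨⟨hxV, hxU⟩, hf₀⟩, X, ε, hX.mono fun x hx => hx.1.1, fun x hx => ?_⟩
  have hmem : ∀ a, X a x ∈ S x := fun a => (hX.frame.isSectionOn a).mem x hx.1.1
  have hli : LinearIndependent ℝ fun a => (⟨X a x, hmem a⟩ : S x) :=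
    LinearIndependent.of_comp (Submodule.subtype (S x))
      (hX.frame.linearIndependent x hx.1.1)
  have : FiniteDimensional ℝ (TangentSpace (𝓡 n) x) :=
    inferInstanceAs (FiniteDimensional ℝ (EuclideanSpace ℝ (Fin n)))
  let e : Module.Basis (Fin k) ℝ (S x) := basisOfLinearIndependentOfCardEqFinrank hli
    (by rw [Fintype.card_fin, hS.finrank_eq x])
  have he : ∀ a, (e a : TangentSpace (𝓡 n) x) = X a x := fun a => by simp [e]
  exact ⟨e, he, (hfo x hx.1 e he).2 hx.2⟩

/-! ### The Lie derivative of the characteristic form -/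

/-- If `σ_i P_i` is dual to a frame `T` of a distribution, then for sections `Y_j` of this
distribution the derivative of `det [g(Y_j, P_i)]` along `Z`, corrected by the brackets
`[Z, Y_j]`, is a multiple of the determinant itself. The expansion of `Y_j` in the frame `T` shows
that the corrected derivative of the matrix is its product with the matrix of
`T_k ↦ [Z, T_k]`, whose trace appears here. -/
theorem mvfderiv_det_metric {ι : Type*} [Fintype ι] [DecidableEq ι]
    {g : SemiRiemannianMetric n s M} {U : Set M} (hU : IsOpen U) {x : M} (hx : x ∈ U)
    {T P Y : ι → VField n M} {σ : ι → ℝ} (hT : ∀ i, SmoothFieldOn (T i) U)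
    (hP : ∀ i, SmoothFieldOn (P i) U) (hY : ∀ j, SmoothFieldOn (Y j) U)
    (hσ : ∀ i, σ i ^ 2 = 1) (hTP : ∀ k i, g x (T k x) (P i x) = if k = i then σ i else 0)
    (hexp : ∀ j, ∀ y ∈ U, Y j y = ∑ k, (σ k * g y (Y j y) (P k y)) • T k y) (Z : VField n M) :
    mvfderiv (𝓡 n) (fun y => (Matrix.of fun j i => g y (Y j y) (P i y)).det) x (Z x) =
      ∑ j, ((Matrix.of fun j i => g x (Y j x) (P i x)).updateRow j fun i =>
        g x (VectorField.mlieBracket (𝓡 n) Z (Y j) x) (P i x)).det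
      - bracketTrace g T P σ Z x * (Matrix.of fun j i => g x (Y j x) (P i x)).det := by
  have hs : ∀ j i, ContMDiffOn (𝓡 n) 𝓘(ℝ, ℝ) ∞ (fun y => g y (Y j y) (P i y)) U := fun j i =>
    g.smooth_apply (hY j) (hP i)
  rw [mvfderiv_det (f := fun y => Matrix.of fun j i => g y (Y j y) (P i y)) hs hU hx]
  set Θ : Matrix ι ι ℝ := Matrix.of fun j i => g x (Y j x) (P i x) with hΘ
  let B : Matrix ι ι ℝ := Matrix.of fun k i =>
    σ k * g x (VectorField.mlieBracket (𝓡 n) Z (T k) x) (P i x)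
  have hentry : ∀ j i, mvfderiv (𝓡 n) (fun y => g y (Y j y) (P i y)) x (Z x)
      = g x (VectorField.mlieBracket (𝓡 n) Z (Y j) x) (P i x) + -(Θ * B) j i := by
    intro j i
    have hd : ∀ k, mvfderiv (𝓡 n) (fun y => σ k * g y (Y j y) (P k y)) x (Z x)
        = σ k * mvfderiv (𝓡 n) (fun y => g y (Y j y) (P k y)) x (Z x) := by
      intro k
      have h1 : (fun y => σ k * g y (Y j y) (P k y))
          = (fun _ => σ k) * fun y => g y (Y j y) (P k y) := rfl
      rw [h1, mvfderiv_mul mdifferentiableAt_const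
        (((hs j k).contMDiffAt (hU.mem_nhds hx)).mdifferentiableAt (by simp)), mvfderiv_const]
      simp
    have hb := mlieBracket_linearCombination_right (Z := Z) hU hx
      (fun k => contMDiffOn_const.mul (hs j k)) hT (f := fun k y => σ k * g y (Y j y) (P k y))
    rw [mlieBracket_congr hU hx (fun y _ => rfl) (hexp j), hb, map_add, add_apply,
      g.sum_smul_left, g.sum_smul_left, Matrix.mul_apply]
    simp only [hd, hTP, mul_ite, mul_zero, Finset.sum_ite_eq', Finset.mem_univ, if_true, B,
      Matrix.of_apply, hΘ]
    have h2 : ∑ k, σ k * g x (Y j x) (P k x)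
          * g x (VectorField.mlieBracket (𝓡 n) Z (T k) x) (P i x)
        = ∑ k, g x (Y j x) (P k x)
          * (σ k * g x (VectorField.mlieBracket (𝓡 n) Z (T k) x) (P i x)) :=
      Finset.sum_congr rfl fun k _ => by ring
    rw [h2]
    linear_combination
      -(mvfderiv (𝓡 n) (fun y => g y (Y j y) (P i y)) x (Z x)) * hσ i
  have htr : B.trace = bracketTrace g T P σ Z x := rfl
  rw [← htr, ← sum_det_updateRow_mul, ← Finset.sum_sub_distrib]
  refine Finset.sum_congr rfl fun j _ => ?_
  have h3 : (fun i => mvfderiv (𝓡 n) (fun y => g y (Y j y) (P i y)) x (Z x))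
      = (fun i => g x (VectorField.mlieBracket (𝓡 n) Z (Y j) x) (P i x))
        + (-1 : ℝ) • (Θ * B) j := by
    ext i
    rw [hentry]
    simp
  simp only [Matrix.of_apply]
  rw [h3, Matrix.det_updateRow_add, Matrix.det_updateRow_smul]
  ring

namespace IsScreenData

variable {g : SemiRiemannianMetric n s M} {F : Foliation n m M} {ξ : Fin r → VField n M}
  {S S' E : TangentSubspaces n M} (h : IsScreenData q g F ξ S S' E)
include h

theorem existsUnique_characteristicForm (hrm : r < m)
    {o : ∀ x : M, Orientation ℝ (S x) (Fin (m - r))} (ho : IsBundleOrientation S o) :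
    ∃! χ : ∀ x : M, TangentSpace (𝓡 n) x [⋀^Fin m]→ₗ[ℝ] ℝ,
      IsCharacteristicForm g S E ξ o χ := by
  choose V hV hxV X ε hX hXo using fun x : M => exists_positive_orthonormalFrame (x₀ := x)
    (by omega) h.screen.screen_subbundle ho h.screen_nondegenerate
  refine ⟨fun x => wedge (coframe m g E ξ (X x) x), ?_, fun χ hχ => ?_⟩
  · intro U X' ε' _ hX' ho' x hx
    exact wedge_coframe_eq hrm.le hX' (hX x) hx (hxV x) (ho' x hx) (hXo x x (hxV x))
  · funext x
    exact hχ (V x) (X x) (ε x) (hV x) (hX x) (hXo x) x (hxV x)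

theorem isSmoothForm_of_isCharacteristicForm (hrm : r < m)
    {o : ∀ x : M, Orientation ℝ (S x) (Fin (m - r))} (ho : IsBundleOrientation S o)
    {χ : ∀ x : M, TangentSpace (𝓡 n) x [⋀^Fin m]→ₗ[ℝ] ℝ}
    (hχ : IsCharacteristicForm g S E ξ o χ) : IsSmoothForm χ := by
  intro U Y hU hY x hx
  obtain ⟨V, hV, hxV, X, ε, hX, hXo⟩ := exists_positive_orthonormalFrame (x₀ := x)
    (by omega) h.screen.screen_subbundle ho h.screen_nondegenerate
  have h1 := contMDiffOn_wedge_coframe (U := U ∩ V) hrm.le h.smooth_nullFrame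
    (fun a => (hX.frame.smooth a).mono inter_subset_right)
    fun j => (hY j).mono inter_subset_left
  refine ((h1.congr fun y hy => ?_).contMDiffAt
    ((hU.inter hV).mem_nhds ⟨hx, hxV⟩)).contMDiffWithinAt
  rw [hχ V X ε hV hX hXo y hy.2]

/-- The expansion of a tangent vector of the foliation in the frame `ξ_i, X_a`. -/
theorem eq_sum_of_mem_tangent {U : Set M} {X : Fin (m - r) → VField n M} {ε : Fin (m - r) → ℝ}
    (hX : IsOrthonormalFrameOn g S X ε U) {x : M} (hx : x ∈ U) {v : TangentSpace (𝓡 n) x}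
    (hv : v ∈ F.tangent x) :
    v = ∑ i, g x v (nullFrame g E ξ i x) • ξ i x + ∑ a, (ε a * g x v (X a x)) • X a x := by
  have hX' : ∀ a, X a x ∈ S x := fun a => (hX.frame.isSectionOn a).mem x hx
  rw [← h.screen.screen_compl.sup_eq x] at hv
  obtain ⟨a, ha, b, hb, rfl⟩ := Submodule.mem_sup.1 hv
  have ha' := ha
  rw [← hX.frame.span_eq x hx] at ha'
  rw [← h.frame.span_eq x (mem_univ x)] at hb
  obtain ⟨c, rfl⟩ := (Submodule.mem_span_range_iff_exists_fun ℝ).1 hb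
  have e1 : ∀ i, g x (a + ∑ i, c i • ξ i x) (nullFrame g E ξ i x) = c i := by
    intro i
    rw [g.symm, map_add, g.sum_smul_right, h.nullFrame_apply_screen i ha]
    simp [h.nullFrame_apply_xi]
  have e2 : ∀ k, g x (a + ∑ i, c i • ξ i x) (X k x) = g x a (X k x) := by
    intro k
    rw [map_add, add_apply, g.sum_smul_left]
    simp [h.xi_apply_tangent _ (h.screen_le (hX' k))]
  simp only [e1, e2]
  rw [← eq_sum_of_orthonormal (v := fun a => X a x) hX.sign_sq (hX.orthonormal x hx) ha',
    add_comm]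

/-- The Lie derivative formula for `χ`: the trace produced by differentiating the determinant is
the value of `κ`. -/
theorem lieDerivative_add_kappa (hrm : r < m)
    {o : ∀ x : M, Orientation ℝ (S x) (Fin (m - r))} (ho : IsBundleOrientation S o)
    {χ : ∀ x : M, TangentSpace (𝓡 n) x [⋀^Fin m]→ₗ[ℝ] ℝ}
    (hχ : IsCharacteristicForm g S E ξ o χ) {κ : ∀ x : M, TangentSpace (𝓡 n) x →L[ℝ] ℝ}
    (hκ : IsKappa g F S S' E ξ κ) {U : Set M} {Z : VField n M} {Y : Fin m → VField n M}
    (hU : IsOpen U) (hZ : IsSectionOn (transversal g S' E ξ) Z U)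
    (hY : ∀ j, IsSectionOn F.tangent (Y j) U) {x : M} (hx : x ∈ U) :
    lieDerivative Z χ Y x + κ x (Z x) * χ x (fun j => Y j x) = 0 := by
  obtain ⟨V, hV, hxV, X, ε, hX, hXo⟩ := exists_positive_orthonormalFrame (x₀ := x)
    (by omega) h.screen.screen_subbundle ho h.screen_nondegenerate
  have hUV : IsOpen (U ∩ V) := hU.inter hV
  have hx' : x ∈ U ∩ V := ⟨hx, hxV⟩
  have hXV := hX.mono (inter_subset_right (s := U))
  have hX' : ∀ a, ∀ y ∈ U ∩ V, X a y ∈ S y := fun a y hy => (hXV.frame.isSectionOn a).mem y hy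
  let P : Fin m → VField n M := coframeField g E ξ X hrm.le
  let e := frameIndex hrm.le
  let T : Fin m → VField n M := fun j => Sum.elim ξ X (e.symm j)
  let σ : Fin m → ℝ := fun j => Sum.elim (fun _ => 1) ε (e.symm j)
  have hP1 : ∀ i, P (e (Sum.inl i)) = nullFrame g E ξ i := fun i => by simp [P, coframeField, e]
  have hP2 : ∀ a, P (e (Sum.inr a)) = X a := fun a => by simp [P, coframeField, e]
  have hT1 : ∀ i, T (e (Sum.inl i)) = ξ i := fun i => by simp [T]
  have hT2 : ∀ a, T (e (Sum.inr a)) = X a := fun a => by simp [T]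
  have hσ1 : ∀ i, σ (e (Sum.inl i)) = 1 := fun i => by simp [σ]
  have hσ2 : ∀ a, σ (e (Sum.inr a)) = ε a := fun a => by simp [σ]
  have hlie := mvfderiv_det_metric (g := g) (T := T) (P := P) (Y := Y) (σ := σ) hUV hx'
    (fun j => by
      obtain ⟨i | a, rfl⟩ := e.surjective j
      · rw [hT1]; exact (h.frame.smooth i).mono (subset_univ _)
      · rw [hT2]; exact hXV.frame.smooth a)
    (fun j => by
      obtain ⟨i | a, rfl⟩ := e.surjective j
      · rw [hP1]; exact (h.smooth_nullFrame i).mono (subset_univ _)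
      · rw [hP2]; exact hXV.frame.smooth a)
    (fun j => (hY j).smooth.mono inter_subset_left)
    (fun j => by
      obtain ⟨i | a, rfl⟩ := e.surjective j
      · rw [hσ1]; norm_num
      · rw [hσ2]; exact hX.sign_sq a)
    (fun k j => by
      obtain ⟨k | c, rfl⟩ := e.surjective k <;> obtain ⟨i | a, rfl⟩ := e.surjective j
      · rw [hT1, hP1, hσ1, g.symm, h.nullFrame_apply_xi]
        simp [eq_comm]
      · rw [hT1, hP2, hσ2, h.xi_apply_tangent k (h.screen_le (hX' a x hx'))]
        simp
      · rw [hT2, hP1, hσ1, g.symm, h.nullFrame_apply_screen i (hX' c x hx')]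
        simp
      · rw [hT2, hP2, hσ2, hXV.orthonormal x hx']
        by_cases hca : c = a <;> simp [hca])
    (fun j y hy => by
      rw [← e.sum_comp, Fintype.sum_sum_type]
      simp only [hP1, hP2, hT1, hT2, hσ1, hσ2, one_mul]
      exact h.eq_sum_of_mem_tangent hXV hy ((hY j).mem y hy.1)) Z
  have htrace : bracketTrace g T P σ Z x = κ x (Z x) := by
    rw [hκ.transversal (U ∩ V) X ε Z hUV hXV (hZ.mono inter_subset_left) x hx', bracketTrace,
      ← e.sum_comp, Fintype.sum_sum_type]
    simp only [hP1, hP2, hT1, hT2, hσ1, hσ2, one_mul]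
  have hform : ∀ y ∈ U ∩ V, ∀ v : Fin m → TangentSpace (𝓡 n) y, χ y v =
      1 / (m.factorial : ℝ) * (Matrix.of fun j i => g y (v j) (P i y)).det := fun y hy v => by
    rw [hχ V X ε hV hX hXo y hy.2, wedge_coframe_apply g E ξ X hrm.le]
  have hder : mvfderiv (𝓡 n) (fun y => χ y fun j => Y j y) x (Z x) = 1 / (m.factorial : ℝ)
      * mvfderiv (𝓡 n) (fun y => (Matrix.of fun j i => g y (Y j y) (P i y)).det) x (Z x) := by
    rw [mvfderiv_congr_of_isOpen (n := n) hUV hx' fun y hy => hform y hy fun j => Y j y]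
    have hsm : ContMDiffOn (𝓡 n) 𝓘(ℝ, ℝ) ∞
        (fun y => (Matrix.of fun j i => g y (Y j y) (P i y)).det) (U ∩ V) :=
      contMDiffOn_det fun j i => g.smooth_apply ((hY j).smooth.mono inter_subset_left) (by
        obtain ⟨i | a, rfl⟩ := e.surjective i
        · rw [hP1]; exact (h.smooth_nullFrame i).mono (subset_univ _)
        · rw [hP2]; exact hXV.frame.smooth a)
    have h1 : (fun y => 1 / (m.factorial : ℝ)
        * (Matrix.of fun j i => g y (Y j y) (P i y)).det)
        = (fun _ => 1 / (m.factorial : ℝ))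
          * fun y => (Matrix.of fun j i => g y (Y j y) (P i y)).det := rfl
    rw [h1, mvfderiv_mul mdifferentiableAt_const
      ((hsm.contMDiffAt (hUV.mem_nhds hx')).mdifferentiableAt (by simp)), mvfderiv_const]
    simp
  have hupd : ∀ j, χ x (Function.update (fun k => Y k x) j
      (VectorField.mlieBracket (𝓡 n) Z (Y j) x)) = 1 / (m.factorial : ℝ)
      * ((Matrix.of fun j i => g x (Y j x) (P i x)).updateRow j fun i =>
        g x (VectorField.mlieBracket (𝓡 n) Z (Y j) x) (P i x)).det := by
    intro j
    rw [hform x hx']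
    congr 2
    ext k i
    rw [Matrix.updateRow_apply, Matrix.of_apply]
    by_cases hk : k = j
    · subst hk; simp
    · simp [hk]
  change mvfderiv (𝓡 n) (fun y => χ y fun j => Y j y) x (Z x) - ∑ j, _ + _ = 0
  rw [hder, hlie, htrace, Finset.sum_congr rfl fun j _ => hupd j, hform x hx', ← Finset.mul_sum]
  ring

end IsScreenData

end

end Lightlike

end

theorem mainTheorem5 {n m q r s : ℕ} {M : Type*} [TopologicalSpace M] [T2Space M]
    [SecondCountableTopology M] [ChartedSpace (EuclideanSpace ℝ (Fin n)) M]
    [IsManifold (𝓡 n) ∞ M] (hmq : m + q = n) (hs : 1 ≤ s) (hsn : s < n)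
    (hr : 1 ≤ r) (hrm : r < m) (hrq : r < q)
    (g : Lightlike.SemiRiemannianMetric n s M) (F : Lightlike.Foliation n m M)
    (ξ : Fin r → Lightlike.VField n M) (hξ : Lightlike.IsFrameOn (F.radical g) ξ univ)
    (S S' E : Lightlike.TangentSubspaces n M) (hS : Lightlike.IsScreenPair q r g F S S')
    (hE : Lightlike.IsRadicalComplement r g F S S' E) :
    ∃ κ : ∀ x : M, TangentSpace (𝓡 n) x →L[ℝ] ℝ,
      Lightlike.IsSmoothOneForm κ ∧ Lightlike.IsKappa g F S S' E ξ κ ∧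
      (∀ κ' : ∀ x : M, TangentSpace (𝓡 n) x →L[ℝ] ℝ,
        Lightlike.IsKappa g F S S' E ξ κ' → κ' = κ) ∧
      ∀ o : ∀ x : M, Orientation ℝ (S x) (Fin (m - r)), Lightlike.IsBundleOrientation S o →
        (∃! χ : ∀ x : M, TangentSpace (𝓡 n) x [⋀^Fin m]→ₗ[ℝ] ℝ,
          Lightlike.IsCharacteristicForm g S E ξ o χ) ∧
        ∀ χ : ∀ x : M, TangentSpace (𝓡 n) x [⋀^Fin m]→ₗ[ℝ] ℝ,
          Lightlike.IsCharacteristicForm g S E ξ o χ → Lightlike.IsSmoothForm χ ∧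
          ∀ (U : Set M) (Z : Lightlike.VField n M) (Y : Fin m → Lightlike.VField n M), IsOpen U →
            Lightlike.IsSectionOn (Lightlike.transversal g S' E ξ) Z U →
            (∀ j, Lightlike.IsSectionOn F.tangent (Y j) U) → ∀ x ∈ U,
              Lightlike.lieDerivative Z χ Y x + κ x (Z x) * χ x (fun j => Y j x) = 0 := by
  have h : Lightlike.IsScreenData q g F ξ S S' E := ⟨hξ, hS, hE⟩
  obtain ⟨κ, hκ⟩ := h.exists_isKappa
  refine ⟨κ, h.isSmoothOneForm_of_isKappa hκ, hκ, fun κ' hκ' => h.isKappa_unique hκ hκ',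
    fun o ho => ⟨h.existsUnique_characteristicForm hrm ho, fun χ hχ =>
      ⟨h.isSmoothForm_of_isCharacteristicForm hrm ho hχ, fun U Z Y hU hZ hY x hx =>
        h.lieDerivative_add_kappa hrm ho hχ hκ hU hZ hY hx⟩⟩⟩
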